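/- Let $\Bbbk$ be an algebraically closed field of characteristic zero, $\mathfrak g$ a finite-dimensional semisimple Lie algebra over $\Bbbk$ with a Cartan subalgebra, root system $\varDelta$ and a fixed base, $\varDelta_+$ the set of positive roots, $Q_+=\mathbb Z\varDelta$ the root lattice and $\mathfrak n_+=\bigoplus_{\beta\in\varDelta_+}\mathfrak g_\beta$. Let $\mathcal Z_\varDelta$ be the Hopf algebra of regular functions on the unipotent algebraic group $N_+$ with Lie algebra $\mathfrak n_+$, realized as the group generated by the elements $\exp(\operatorname{ad}x)$, $x\in\mathfrak n_+$, in $GL(\mathfrak g)$. It is $Q_+$-graded: $f$ has degree $\nu$ if $f(tut^{-1})=\nu(t)f(u)$ for all $u\in N_+$ and all $t$ in the adjoint torus $\operatorname{Hom}(Q_+,\Bbbk^\times)$, which acts on $\mathfrak g_\beta$ by evaluation at $\beta$ and trivially on the Cartan subalgebra. Then there exist homogeneous elements $z_\beta\in\mathcal Z_\varDelta$ of degree $\beta$, $\beta\in\varDelta_+$, such that $\mathcal Z_\varDelta=\Bbbk[z_\beta\,|\,\beta\in\varDelta_+]$ is the polynomial algebra in the $z_\beta$. For every such family $(z_\beta)$,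 the assignment $$B\longmapsto I(B)=\langle z_\beta\,|\,\beta\in\varDelta_+\setminus B\rangle$$ is an anti-isomorphism of posets (both ordered by inclusion) from the set of subsets $B\subseteq\varDelta_+$ closed by sums (that is, $\alpha,\beta\in B$ and $\alpha+\beta\in\varDelta_+$ imply $\alpha+\beta\in B$) onto the set of $Q_+$-graded Hopf ideals of $\mathcal Z_\varDelta$. -/

import Mathlib

namespace UnipotentCoord

open scoped TensorProduct

section LinearGroup

variable {k V : Type*} [Field k] [AddCommGroup V] [Module k V]

/-- The algebra of regular functions on a linear group `N ⊆ GL(V)`, as a subalgebra of the algebra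
of all functions `N → k`: it is generated by the matrix entries of `u` and of `u⁻¹`. -/
def coordSubalgebra (N : Subgroup (V ≃ₗ[k] V)) : Subalgebra k (N → k) :=
  Algebra.adjoin k
    ({f | ∃ (φ : Module.Dual k V) (v : V), f = fun u : N => φ ((u : V ≃ₗ[k] V) v)} ∪
     {f | ∃ (φ : Module.Dual k V) (v : V), f = fun u : N => φ (((u⁻¹ : N) : V ≃ₗ[k] V) v)})

/-- The coordinate algebra `k[N]` of a linear group `N ⊆ GL(V)`. -/
def CoordRing (N : Subgroup (V ≃ₗ[k] V)) : Type _ := coordSubalgebra N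

instance (N : Subgroup (V ≃ₗ[k] V)) : CommRing (CoordRing N) :=
  inferInstanceAs (CommRing (coordSubalgebra N))

instance (N : Subgroup (V ≃ₗ[k] V)) : Algebra k (CoordRing N) :=
  inferInstanceAs (Algebra k (coordSubalgebra N))

instance (N : Subgroup (V ≃ₗ[k] V)) : FunLike (CoordRing N) N k where
  coe f := f.1
  coe_injective _ _ h := Subtype.ext h

/-- Evaluation of a regular function at a point of the group. -/
def evalAt (N : Subgroup (V ≃ₗ[k] V)) (u : N) : CoordRing N →ₐ[k] k :=
  (Pi.evalAlgHom k (fun _ : N => k) u).comp (coordSubalgebra N).val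

@[simp] lemma evalAt_apply (N : Subgroup (V ≃ₗ[k] V)) (u : N) (f : CoordRing N) :
    evalAt N u f = f u := rfl

@[simp] lemma zero_apply (N : Subgroup (V ≃ₗ[k] V)) (u : N) : (0 : CoordRing N) u = 0 := rfl
@[simp] lemma one_apply (N : Subgroup (V ≃ₗ[k] V)) (u : N) : (1 : CoordRing N) u = 1 := rfl
@[simp] lemma add_apply (N : Subgroup (V ≃ₗ[k] V)) (f f' : CoordRing N) (u : N) :
    (f + f') u = f u + f' u := rfl
@[simp] lemma mul_apply (N : Subgroup (V ≃ₗ[k] V)) (f f' : CoordRing N) (u : N) :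
    (f * f') u = f u * f' u := rfl
@[simp] lemma smul_apply (N : Subgroup (V ≃ₗ[k] V)) (c : k) (f : CoordRing N) (u : N) :
    (c • f) u = c * f u := rfl

lemma coordRing_ext {N : Subgroup (V ≃ₗ[k] V)} {f f' : CoordRing N}
    (h : ∀ u, evalAt N u f = evalAt N u f') : f = f' :=
  DFunLike.ext _ _ h

/-- Jointly injective families of functionals stay jointly injective on tensor products. -/
lemma tensor_separate {A M : Type*} [AddCommGroup A] [Module k A] [AddCommGroup M] [Module k M]
    {ι κ : Type*} (φ : ι → A →ₗ[k] k) (ψ : κ → M →ₗ[k] k)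
    (hφ : ∀ a, (∀ i, φ i a = 0) → a = 0) (hψ : ∀ m, (∀ j, ψ j m = 0) → m = 0)
    (t : A ⊗[k] M) (ht : ∀ i j, TensorProduct.lid k k (TensorProduct.map (φ i) (ψ j) t) = 0) :
    t = 0 := by
  classical
  let b := Module.Basis.ofVectorSpace k A
  obtain ⟨c, rfl⟩ := TensorProduct.eq_repr_basis_left b t
  suffices hc : ∀ i, c i = 0 by
    rw [show c = 0 from Finsupp.ext hc, Finsupp.sum_zero_index]
  intro i
  refine hψ _ fun j => ?_
  have h0 : (c.mapRange (ψ j) (map_zero _)).sum (fun i r => r • b i) = 0 := by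
    refine hφ _ fun l => ?_
    have := ht l j
    rw [Finsupp.sum_mapRange_index (by simp)]
    simp only [Finsupp.sum, map_sum, TensorProduct.map_tmul, TensorProduct.lid_tmul,
      smul_eq_mul, map_smul] at this ⊢
    rw [← this]
    exact Finset.sum_congr rfl fun x _ => mul_comm _ _
  have h1 := (linearIndependent_iff.mp b.linearIndependent) (c.mapRange (ψ j) (map_zero _))
    (by simpa [Finsupp.linearCombination_apply] using h0)
  simpa using DFunLike.congr_fun h1 i

variable (N : Subgroup (V ≃ₗ[k] V))

/-- An element of `k[N] ⊗ k[N]`, seen as a function on `N × N`. -/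
noncomputable def toFun₂ : CoordRing N ⊗[k] CoordRing N →ₐ[k] (N × N → k) :=
  AlgHom.pi fun p => (Algebra.TensorProduct.lift (evalAt N p.1) (evalAt N p.2)
    (fun _ _ => Commute.all _ _))

@[simp] lemma toFun₂_tmul (f f' : CoordRing N) (p : N × N) :
    toFun₂ N (f ⊗ₜ f') p = f p.1 * f' p.2 := by
  exact Algebra.TensorProduct.lift_tmul _ _ (fun _ _ => Commute.all _ _) _ _

lemma toFun₂_eq (t : CoordRing N ⊗[k] CoordRing N) (p : N × N) :
    toFun₂ N t p = TensorProduct.lid k k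
      (TensorProduct.map (evalAt N p.1).toLinearMap (evalAt N p.2).toLinearMap t) := by
  induction t with
  | zero => simp
  | add x y hx hy => simp only [map_add, Pi.add_apply, hx, hy]
  | tmul x y => simp

lemma evalAt_separate (f : CoordRing N) (h : ∀ u, (evalAt N u).toLinearMap f = 0) : f = 0 :=
  coordRing_ext (by simpa using h)

lemma toFun₂_injective : Function.Injective (toFun₂ N) := by
  refine (injective_iff_map_eq_zero _).2 fun t ht => ?_
  refine tensor_separate (fun u => (evalAt N u).toLinearMap) (fun u => (evalAt N u).toLinearMap)
    (evalAt_separate N) (evalAt_separate N) t fun i j => ?_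
  have := congrFun ht (i, j)
  rwa [toFun₂_eq] at this

/-- Pullback of functions along the group law `N × N → N`. -/
def pullMul : CoordRing N →ₐ[k] (N × N → k) :=
  AlgHom.pi fun p => evalAt N (p.1 * p.2)

@[simp] lemma pullMul_apply (f : CoordRing N) (p : N × N) :
    pullMul N f p = f (p.1 * p.2) := rfl

/-- The matrix entry `u ↦ φ (u v)`. -/
def entry (φ : Module.Dual k V) (v : V) : CoordRing N :=
  ⟨fun u : N => φ ((u : V ≃ₗ[k] V) v), Algebra.subset_adjoin (Or.inl ⟨φ, v, rfl⟩)⟩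

/-- The matrix entry `u ↦ φ (u⁻¹ v)` of the inverse. -/
def entryInv (φ : Module.Dual k V) (v : V) : CoordRing N :=
  ⟨fun u : N => φ (((u⁻¹ : N) : V ≃ₗ[k] V) v), Algebra.subset_adjoin (Or.inr ⟨φ, v, rfl⟩)⟩

@[simp] lemma entry_apply (φ : Module.Dual k V) (v : V) (u : N) :
    entry N φ v u = φ ((u : V ≃ₗ[k] V) v) := rfl

@[simp] lemma entryInv_apply (φ : Module.Dual k V) (v : V) (u : N) :
    entryInv N φ v u = φ (((u⁻¹ : N) : V ≃ₗ[k] V) v) := rfl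

lemma coordRing_induction {p : CoordRing N → Prop}
    (_entry : ∀ φ v, p (entry N φ v)) (_entry_inv : ∀ φ v, p (entryInv N φ v))
    (_const : ∀ c, p (algebraMap k _ c)) (_add : ∀ f f', p f → p f' → p (f + f'))
    (_mul : ∀ f f', p f → p f' → p (f * f')) (f : CoordRing N) : p f := by
  obtain ⟨f, hf⟩ := f
  refine Algebra.adjoin_induction (p := fun f hf => p ⟨f, hf⟩) ?_ _const
    (fun x y hx hy => _add ⟨x, hx⟩ ⟨y, hy⟩) (fun x y hx hy => _mul ⟨x, hx⟩ ⟨y, hy⟩) hf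
  rintro x (⟨φ, v, rfl⟩ | ⟨φ, v, rfl⟩)
  · exact _entry φ v
  · exact _entry_inv φ v

/-- The inversion of `N` acts on regular functions. -/
def antipodeHom : CoordRing N →ₐ[k] CoordRing N :=
  (AlgHom.pi fun u : N => evalAt N u⁻¹).codRestrict (coordSubalgebra N) fun f => by
    induction f using coordRing_induction with
    | _entry φ v => exact (entryInv N φ v).2
    | _entry_inv φ v => 
      convert! (entry N φ v).2 using 1
    | _const c => rw [AlgHom.commutes]; exact Subalgebra.algebraMap_mem _ c
    | _add f f' h h' => rw [map_add]; exact add_mem h h'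
    | _mul f f' h h' => rw [map_mul]; exact mul_mem h h'

@[simp] lemma antipodeHom_apply (f : CoordRing N) (u : N) :
    antipodeHom N f u = f u⁻¹ := rfl

/-- Evaluation of an element of `k[N] ⊗ (k[N] ⊗ k[N])` at a triple of points. -/
noncomputable def eval₃ (u v w : N) :
    CoordRing N ⊗[k] (CoordRing N ⊗[k] CoordRing N) →ₗ[k] k :=
  (TensorProduct.lid k k).toLinearMap ∘ₗ TensorProduct.map (evalAt N u).toLinearMap
    ((LinearMap.proj (v, w)) ∘ₗ (toFun₂ N).toLinearMap)

lemma eval₃_tmul (u v w : N) (f : CoordRing N) (t : CoordRing N ⊗[k] CoordRing N) :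
    eval₃ N u v w (f ⊗ₜ t) = f u * toFun₂ N t (v, w) := by
  simp [eval₃]

lemma eval₃_ext (s t : CoordRing N ⊗[k] (CoordRing N ⊗[k] CoordRing N))
    (h : ∀ u v w, eval₃ N u v w s = eval₃ N u v w t) : s = t := by
  rw [← sub_eq_zero]
  refine tensor_separate (fun u => (evalAt N u).toLinearMap)
    (fun p : N × N => (LinearMap.proj p) ∘ₗ (toFun₂ N).toLinearMap)
    (evalAt_separate N) (fun m hm => ?_) (s - t) fun u p => ?_
  · exact (map_eq_zero_iff _ (toFun₂_injective N)).1 (funext hm)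
  · have := h u p.1 p.2
    rw [← sub_eq_zero, ← map_sub] at this
    exact this

lemma eval₃_assoc (u v w : N) (s : CoordRing N ⊗[k] CoordRing N) (f : CoordRing N) :
    eval₃ N u v w (TensorProduct.assoc k _ _ _ (s ⊗ₜ f)) =
      toFun₂ N s (u, v) * f w := by
  induction s with
  | zero => simp
  | add x y hx hy =>
    rw [TensorProduct.add_tmul, map_add, map_add, hx, hy, map_add, Pi.add_apply, add_mul]
  | tmul x y => simp [eval₃_tmul, mul_assoc]

lemma counit_left (u : N) (t : CoordRing N ⊗[k] CoordRing N) :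
    evalAt N u (Algebra.TensorProduct.lid k _
      (Algebra.TensorProduct.map (evalAt N 1) (.id k _) t)) = toFun₂ N t (1, u) := by
  induction t with
  | zero => simp
  | add x y hx hy => rw [map_add, map_add, map_add, hx, hy, map_add, Pi.add_apply]
  | tmul x y => simp

lemma counit_right (u : N) (t : CoordRing N ⊗[k] CoordRing N) :
    evalAt N u (Algebra.TensorProduct.rid k k _
      (Algebra.TensorProduct.map (.id k _) (evalAt N 1) t)) = toFun₂ N t (u, 1) := by
  induction t with
  | zero => simp
  | add x y hx hy => rw [map_add, map_add, map_add, hx, hy, map_add, Pi.add_apply]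
  | tmul x y => simp [mul_comm]

lemma antipode_left (u : N) (t : CoordRing N ⊗[k] CoordRing N) :
    evalAt N u (LinearMap.mul' k _ ((antipodeHom N).toLinearMap.rTensor _ t)) =
      toFun₂ N t (u⁻¹, u) := by
  induction t with
  | zero => simp
  | add x y hx hy => rw [map_add, map_add, map_add, hx, hy, map_add, Pi.add_apply]
  | tmul x y => simp

lemma antipode_right (u : N) (t : CoordRing N ⊗[k] CoordRing N) :
    evalAt N u (LinearMap.mul' k _ ((antipodeHom N).toLinearMap.lTensor _ t)) =
      toFun₂ N t (u, u⁻¹) := by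
  induction t with
  | zero => simp
  | add x y hx hy => rw [map_add, map_add, map_add, hx, hy, map_add, Pi.add_apply]
  | tmul x y => simp

variable [FiniteDimensional k V]

lemma pullMul_mem_range (f : CoordRing N) : pullMul N f ∈ (toFun₂ N).range := by
  let b := Module.finBasis k V
  induction f using coordRing_induction with
  | _entry φ v =>
    refine ⟨∑ i, entry N φ (b i) ⊗ₜ entry N (b.coord i) v, ?_⟩
    ext p
    change toFun₂ N _ p = _
    rw [map_sum, Finset.sum_apply]
    simp only [toFun₂_tmul, pullMul_apply, entry_apply, Subgroup.coe_mul, LinearEquiv.mul_apply]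
    conv_rhs => rw [← b.sum_repr ((p.2 : V ≃ₗ[k] V) v), map_sum, map_sum]
    simp [mul_comm]
  | _entry_inv φ v =>
    refine ⟨∑ i, entryInv N (b.coord i) v ⊗ₜ
      entryInv N φ (b i), ?_⟩
    ext p
    change toFun₂ N _ p = _
    rw [map_sum, Finset.sum_apply]
    simp only [toFun₂_tmul, pullMul_apply, entryInv_apply, mul_inv_rev, Subgroup.coe_mul, LinearEquiv.mul_apply]
    conv_rhs => rw [← b.sum_repr (((p.1⁻¹ : N) : V ≃ₗ[k] V) v), map_sum, map_sum]
    simp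
  | _const c => rw [AlgHom.commutes]; exact Subalgebra.algebraMap_mem _ c
  | _add f f' h h' => rw [map_add]; exact add_mem h h'
  | _mul f f' h h' => rw [map_mul]; exact mul_mem h h'

/-- The comultiplication of `k[N]`: `Δ f` is the function `(u, w) ↦ f (u w)` on `N × N`. -/
noncomputable def comulHom : CoordRing N →ₐ[k] CoordRing N ⊗[k] CoordRing N :=
  (AlgEquiv.ofInjective (toFun₂ N) (toFun₂_injective N)).symm.toAlgHom.comp
    ((pullMul N).codRestrict (toFun₂ N).range (pullMul_mem_range N))

@[simp] lemma toFun₂_comulHom (f : CoordRing N) (p : N × N) :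
    toFun₂ N (comulHom N f) p = f (p.1 * p.2) := by
  have h : toFun₂ N (comulHom N f) = pullMul N f :=
    congrArg Subtype.val ((AlgEquiv.ofInjective (toFun₂ N) (toFun₂_injective N)).apply_symm_apply
      ((pullMul N).codRestrict (toFun₂ N).range (pullMul_mem_range N) f))
  rw [h, pullMul_apply]

lemma lid_map_evalAt_comulHom (u w : N) (f : CoordRing N) :
    TensorProduct.lid k k (TensorProduct.map (evalAt N u).toLinearMap (evalAt N w).toLinearMap
      (comulHom N f)) = f (u * w) := by
  rw [← toFun₂_eq N _ (u, w), toFun₂_comulHom]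

lemma eval₃_left (u v w : N) (t : CoordRing N ⊗[k] CoordRing N) :
    eval₃ N u v w (TensorProduct.assoc k _ _ _
      (Algebra.TensorProduct.map (comulHom N) (.id k _) t)) = toFun₂ N t (u * v, w) := by
  induction t with
  | zero => simp
  | add x y hx hy => rw [map_add, map_add, map_add, hx, hy, map_add, Pi.add_apply]
  | tmul x y => rw [Algebra.TensorProduct.map_tmul, eval₃_assoc, toFun₂_comulHom]; simp

lemma eval₃_right (u v w : N) (t : CoordRing N ⊗[k] CoordRing N) :
    eval₃ N u v w (Algebra.TensorProduct.map (.id k _) (comulHom N) t) =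
      toFun₂ N t (u, v * w) := by
  induction t with
  | zero => simp
  | add x y hx hy => rw [map_add, map_add, hx, hy, map_add, Pi.add_apply]
  | tmul x y => rw [Algebra.TensorProduct.map_tmul, eval₃_tmul, toFun₂_comulHom]; simp

/-- The bialgebra structure of `k[N]`: comultiplication `(Δ f)(u, w) = f (u w)`, counit
`ε f = f 1`. -/
noncomputable instance : Bialgebra k (CoordRing N) :=
  Bialgebra.ofAlgHom (comulHom N) (evalAt N 1)
    (AlgHom.ext fun f => eval₃_ext N _ _ fun u v w =>
      (eval₃_left N u v w (comulHom N f)).trans <| by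
        refine Eq.trans ?_ (eval₃_right N u v w (comulHom N f)).symm
        simp [mul_assoc])
    (AlgHom.ext fun f => (Algebra.TensorProduct.lid k (CoordRing N)).injective <|
      coordRing_ext fun u => (counit_left N u (comulHom N f)).trans <| by simp)
    (AlgHom.ext fun f => (Algebra.TensorProduct.rid k k (CoordRing N)).injective <|
      coordRing_ext fun u => (counit_right N u (comulHom N f)).trans <| by simp)

/-- The Hopf algebra structure of `k[N]`, with antipode `(S f)(u) = f (u⁻¹)`. -/
noncomputable instance : HopfAlgebra k (CoordRing N) where
  antipode := (antipodeHom N).toLinearMap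
  mul_antipode_rTensor_comul := LinearMap.ext fun f => coordRing_ext fun u =>
    (antipode_left N u (comulHom N f)).trans <| by
      rw [toFun₂_comulHom, inv_mul_cancel]
      rfl
  mul_antipode_lTensor_comul := LinearMap.ext fun f => coordRing_ext fun u =>
    (antipode_right N u (comulHom N f)).trans <| by
      rw [toFun₂_comulHom, mul_inv_cancel]
      rfl

end LinearGroup
section RootGrading

open LieAlgebra LieAlgebra.IsKilling LieModule

variable {k g : Type*} [Field k] [CharZero k] [LieRing g] [LieAlgebra k g] [IsKilling k g]
  [FiniteDimensional k g] {H : LieSubalgebra k g} [H.IsCartanSubalgebra]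
  [IsTriangularizable k H g]

variable (H) in
/-- The root lattice of `(g, H)`. -/
abbrev RootLattice : Type _ := (rootSystem H).rootSpan ℤ

/-- The positive roots of `(g, H)` with respect to a base `b`. -/
abbrev PosRoot (b : (rootSystem H).Base) : Type _ := {i : H.root // b.IsPos i}

/-- A positive root as an element of the root lattice. -/
noncomputable def PosRoot.deg {b : (rootSystem H).Base} (β : PosRoot b) : RootLattice H :=
  (rootSystem H).rootSpanMem ℤ β.1

/-- `B ⊆ Δ₊` is closed by sums: if `α, β ∈ B` and `α + β` is a positive root, it lies in `B`. -/
def ClosedBySums {b : (rootSystem H).Base} (B : Set (PosRoot b)) : Prop :=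
  ∀ α ∈ B, ∀ β ∈ B, ∀ γ : PosRoot b, γ.deg = α.deg + β.deg → γ ∈ B

/-- `n₊`, the sum of the root spaces of the positive roots. -/
def nPlus (b : (rootSystem H).Base) : Submodule k g :=
  ⨆ β : PosRoot b, (rootSpace H (β.1 : Weight k H g)).toSubmodule

/-- `exp (ad x)`, for `ad x` nilpotent. -/
noncomputable def expAd (x : g) : Module.End k g :=
  ∑ n ∈ Finset.range (nilpotencyClass (ad k g x)), (n.factorial : k)⁻¹ • (ad k g x) ^ n

/-- The unipotent group with Lie algebra `n₊`, in the adjoint representation (faithful on `n₊`, as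
`g` has trivial centre): the subgroup of `GL(g)` generated by the `exp (ad x)`, `x ∈ n₊`. -/
def unipotentGroup (b : (rootSystem H).Base) : Subgroup (g ≃ₗ[k] g) :=
  Subgroup.closure {u | ∃ x ∈ nPlus b, (u : g →ₗ[k] g) = expAd x}

/-- The coordinate Hopf algebra `Z_Δ` of the unipotent group with Lie algebra `n₊`. -/
abbrev ZDelta (b : (rootSystem H).Base) : Type _ := CoordRing (unipotentGroup b)

/-- A weight of the adjoint representation (a root, or zero) as an element of the root lattice. -/
noncomputable def weightDeg (α : Weight k H g) : RootLattice H :=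
  ⟨α.toLinear, by
    by_cases hα : α.IsZero
    · have : α.toLinear = 0 := by
        ext x
        exact congrFun hα x
      rw [this]
      exact zero_mem _
    · exact Submodule.subset_span ⟨⟨α, by simpa using hα⟩, rfl⟩⟩

/-- `t ∈ GL(g)` is the element of the adjoint torus given by the character `χ` of the root
lattice: it acts on the root space of `α` by `χ α`, and trivially on `H`. -/
def IsTorusElement (χ : AddChar (RootLattice H) k) (t : g ≃ₗ[k] g) : Prop :=
  ∀ (α : Weight k H g), ∀ x ∈ rootSpace H α, t x = χ (weightDeg α) • x

/-- The degree `ν` part of `Z_Δ`: the functions on which the adjoint torus, acting on the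
unipotent group by conjugation, acts through the weight `ν`. -/
def gradedPart (b : (rootSystem H).Base) (ν : RootLattice H) : Submodule k (ZDelta b) where
  carrier := {f | ∀ (χ : AddChar (RootLattice H) k) (t : g ≃ₗ[k] g), IsTorusElement χ t →
    ∀ u u' : unipotentGroup b, (u' : g ≃ₗ[k] g) = t * u * t⁻¹ → f u' = χ ν * f u}
  add_mem' hf hf' χ t ht u u' h := by
    rw [add_apply, add_apply, hf χ t ht u u' h, hf' χ t ht u u' h, mul_add]
  zero_mem' χ t ht u u' h := by simp
  smul_mem' c f hf χ t ht u u' h := by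
    rw [smul_apply, smul_apply, hf χ t ht u u' h, mul_left_comm]

lemma iSup_rootSpace_eq_top :
    ⨆ α : Weight k H g, (rootSpace H α).toSubmodule = ⊤ := by
  rw [← LieSubmodule.iSup_toSubmodule, iSup_genWeightSpace_eq_top', LieSubmodule.top_toSubmodule]

lemma isInternal_rootSpace [DecidableEq (Weight k H g)] :
    DirectSum.IsInternal fun α : Weight k H g => (rootSpace H α).toSubmodule :=
  DirectSum.isInternal_submodule_of_iSupIndep_of_iSup_eq_top
    (LieSubmodule.iSupIndep_toSubmodule.mpr (iSupIndep_genWeightSpace' k H g))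
    iSup_rootSpace_eq_top

/-- A linear map on `g` may be prescribed to act by scalars on the weight spaces. -/
lemma exists_diagonal (c : Weight k H g → k) :
    ∃ t : g →ₗ[k] g, ∀ (α : Weight k H g), ∀ x ∈ rootSpace H α, t x = c α • x := by
  classical
  let e := LinearEquiv.ofBijective
    (DirectSum.coeLinearMap fun α : Weight k H g => (rootSpace H α).toSubmodule)
    isInternal_rootSpace
  refine ⟨(DirectSum.toModule k _ g fun α =>
    c α • (rootSpace H α).toSubmodule.subtype) ∘ₗ e.symm.toLinearMap, fun α x hx => ?_⟩
  have : e.symm x = DirectSum.lof k _ (fun α : Weight k H g => (rootSpace H α).toSubmodule) α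
      ⟨x, hx⟩ := by
    rw [LinearEquiv.symm_apply_eq]
    exact (DirectSum.coeLinearMap_lof _ α ⟨x, hx⟩).symm
  simp [this]

lemma weight_ext {M : Type*} [AddCommGroup M] [Module k M] {t t' : g →ₗ[k] M}
    (h : ∀ (α : Weight k H g), ∀ x ∈ rootSpace H α, t x = t' x) : t = t' := by
  rw [← LinearMap.eqLocus_eq_top, eq_top_iff, ← iSup_rootSpace_eq_top (H := H), iSup_le_iff]
  exact fun α x hx => h α x hx

lemma exists_torusElement (χ : AddChar (RootLattice H) k) :
    ∃ t : g ≃ₗ[k] g, IsTorusElement χ t := by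
  obtain ⟨t, ht⟩ := exists_diagonal (H := H) fun α => χ (weightDeg α)
  obtain ⟨s, hs⟩ := exists_diagonal (H := H) fun α => χ (-weightDeg α)
  have hχ (ν : RootLattice H) : χ ν * χ (-ν) = 1 := by
    rw [← AddChar.map_add_eq_mul, add_neg_cancel, AddChar.map_zero_eq_one]
  refine ⟨LinearEquiv.ofLinearMap t s (weight_ext (H := H) fun α x hx => ?_)
    (weight_ext (H := H) fun α x hx => ?_),
    fun α x hx => ht α x hx⟩
  · rw [LinearMap.comp_apply, hs α x hx, map_smul, ht α x hx, smul_smul, mul_comm, hχ, one_smul,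
      LinearMap.id_apply]
  · rw [LinearMap.comp_apply, ht α x hx, map_smul, hs α x hx, smul_smul, hχ, one_smul,
      LinearMap.id_apply]

lemma weightDeg_posRoot {b : (rootSystem H).Base} (β : PosRoot b) :
    weightDeg (β.1 : Weight k H g) = β.deg := rfl

namespace IsTorusElement

variable {χ : AddChar (RootLattice H) k} {t : g ≃ₗ[k] g}

lemma map_lie (ht : IsTorusElement χ t) (x y : g) : t ⁅x, y⁆ = ⁅t x, t y⁆ := by
  have hx : x ∈ ⨆ α : Weight k H g, (rootSpace H α).toSubmodule := by
    rw [iSup_rootSpace_eq_top]; trivial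
  have hy : y ∈ ⨆ α : Weight k H g, (rootSpace H α).toSubmodule := by
    rw [iSup_rootSpace_eq_top]; trivial
  induction hx using Submodule.iSup_induction' with
  | zero => simp
  | add x x' _ _ h h' => simp [h, h']
  | mem α x hx =>
    induction hy using Submodule.iSup_induction' with
    | zero => simp
    | add y y' _ _ h h' => simp [h, h']
    | mem β y hy =>
      have hxy : ⁅x, y⁆ ∈ rootSpace H (α + β : H → k) :=
        lie_mem_genWeightSpace_of_mem_genWeightSpace hx hy
      rw [ht α x hx, ht β y hy, smul_lie, lie_smul, smul_smul, ← AddChar.map_add_eq_mul]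
      by_cases h0 : rootSpace H (α + β : H → k) = ⊥
      · rw [h0, LieSubmodule.mem_bot] at hxy
        rw [hxy, map_zero, smul_zero]
      · rw [ht ⟨α + β, h0⟩ _ hxy]
        rfl

lemma mem_nPlus {b : (rootSystem H).Base} (ht : IsTorusElement χ t) {x : g} (hx : x ∈ nPlus b) :
    t x ∈ nPlus b := by
  induction hx using Submodule.iSup_induction' with
  | zero => simp
  | add x x' _ _ h h' => rw [map_add]; exact add_mem h h'
  | mem β x hx =>
    rw [ht _ x hx]
    exact Submodule.smul_mem _ _ (Submodule.mem_iSup_of_mem β hx)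

lemma conj_mem {b : (rootSystem H).Base} (ht : IsTorusElement χ t) {u : g ≃ₗ[k] g}
    (hu : u ∈ unipotentGroup b) : t * u * t⁻¹ ∈ unipotentGroup b := by
  suffices h : unipotentGroup b ≤ (unipotentGroup b).comap (MulAut.conj t).toMonoidHom from h hu
  refine (Subgroup.closure_le _).2 ?_
  rintro v ⟨x, hx, hv⟩
  refine Subgroup.subset_closure ⟨t x, ht.mem_nPlus hx, ?_⟩
  have had : ad k g (t x) = t.conjAlgEquiv k (ad k g x) := by
    ext y
    simp [LinearEquiv.conjAlgEquiv_apply, ht.map_lie]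
  have hcl : nilpotencyClass (ad k g (t x)) = nilpotencyClass (ad k g x) := by
    rw [had]
    simp only [nilpotencyClass, ← map_pow, EmbeddingLike.map_eq_zero_iff]
  have hexp : expAd (t x) = t.conjAlgEquiv k (expAd x) := by
    rw [expAd, hcl, had]
    simp only [expAd, map_sum, map_smul, map_pow]
  rw [hexp, ← hv]
  rfl

end IsTorusElement

section Grading

variable (b : (rootSystem H).Base)

lemma one_mem_gradedPart : (1 : ZDelta b) ∈ gradedPart b 0 := fun χ t _ u u' _ => by
  rw [one_apply, one_apply, AddChar.map_zero_eq_one, mul_one]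

variable {b} in
lemma mul_mem_gradedPart {ν ν' : RootLattice H} {f f' : ZDelta b} (hf : f ∈ gradedPart b ν)
    (hf' : f' ∈ gradedPart b ν') : f * f' ∈ gradedPart b (ν + ν') := fun χ t ht u u' h => by
  rw [mul_apply, mul_apply, hf χ t ht u u' h, hf' χ t ht u u' h, AddChar.map_add_eq_mul]
  ring

instance : SetLike.GradedMonoid (gradedPart b) where
  one_mem := one_mem_gradedPart b
  mul_mem _ _ _ _ hf hf' := mul_mem_gradedPart hf hf'

/-- Characters separate the points of the root lattice. -/
lemma exists_addChar_ne_one {ν : RootLattice H} (hν : ν ≠ 0) :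
    ∃ χ : AddChar (RootLattice H) k, χ ν ≠ 1 := by
  have : Module.Free ℤ (RootLattice H) := Module.free_of_finite_type_torsion_free'
  obtain ⟨f, hf⟩ : ∃ f : Module.Dual ℤ (RootLattice H), f ν ≠ 0 := by
    by_contra! h
    exact hν ((Module.forall_dual_apply_eq_zero_iff ℤ ν).1 h)
  refine ⟨{ toFun := fun q => (2 : k) ^ (f q)
            map_zero_eq_one' := by simp
            map_add_eq_mul' := fun x y => by rw [map_add, zpow_add₀ two_ne_zero] }, ?_⟩
  intro h
  have h' : ((2 : ℚ) ^ (f ν) : ℚ) = 1 := by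
    have : (((2 : ℚ) ^ (f ν) : ℚ) : k) = ((1 : ℚ) : k) := by
      push_cast
      exact h
    exact_mod_cast this
  rw [zpow_eq_one_iff_right₀ (by norm_num) (by norm_num)] at h'
  exact hf h'

/-- Evaluation at a point of the root lattice, as a character of the torus. -/
noncomputable def evalChar (ν : RootLattice H) : AddChar (RootLattice H) k →* k where
  toFun χ := χ ν
  map_one' := rfl
  map_mul' _ _ := rfl

lemma evalChar_injective :
    Function.Injective (evalChar : RootLattice H → (AddChar (RootLattice H) k →* k)) := by
  intro ν ν' h
  by_contra hne
  obtain ⟨χ, hχ⟩ := exists_addChar_ne_one (sub_ne_zero.2 hne)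
  refine hχ ?_
  have h1 : χ ν = χ ν' := DFunLike.congr_fun h χ
  have h2 : χ (ν - ν') * χ ν' = 1 * χ ν' := by
    rw [← AddChar.map_add_eq_mul, sub_add_cancel, h1, one_mul]
  have h3 : χ ν' * χ (-ν') = 1 := by
    rw [← AddChar.map_add_eq_mul, add_neg_cancel, AddChar.map_zero_eq_one]
  exact mul_right_cancel₀ (left_ne_zero_of_mul_eq_one h3) h2

lemma gradedPart_coe_injective [DecidableEq (RootLattice H)] :
    Function.Injective (DirectSum.coeLinearMap (gradedPart b)) := by
  classical
  refine (injective_iff_map_eq_zero _).2 fun x hx => ?_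
  have hli : LinearIndependent k fun ν : RootLattice H =>
      (⇑(evalChar (k := k) ν) : AddChar (RootLattice H) k → k) :=
    (linearIndependent_monoidHom (AddChar (RootLattice H) k) k).comp _ evalChar_injective
  have key (u : unipotentGroup b) : ∀ ν ∈ x.support, ((x ν : ZDelta b) u) = 0 := by
    refine linearIndependent_iff'.1 hli x.support (fun ν => (x ν : ZDelta b) u) ?_
    ext χ
    obtain ⟨t, ht⟩ := exists_torusElement χ
    have h0 := congrArg (evalAt (unipotentGroup b) ⟨t * u * t⁻¹, ht.conj_mem u.2⟩) hx
    rw [DirectSum.coeLinearMap_eq_dfinsuppSum, DFinsupp.sum, map_sum, map_zero] at h0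
    rw [Finset.sum_apply, Pi.zero_apply, ← h0]
    refine Finset.sum_congr rfl fun ν _ => ?_
    rw [evalAt_apply, (x ν).2 χ t ht u ⟨t * u * t⁻¹, ht.conj_mem u.2⟩ rfl, Pi.smul_apply, smul_eq_mul, mul_comm]
    rfl
  refine DFinsupp.ext fun ν => Subtype.ext (coordRing_ext fun u => ?_)
  by_cases hν : ν ∈ x.support
  · exact key u ν hν
  · rw [DFinsupp.notMem_support_iff.1 hν]
    rfl

lemma entry_mem_gradedPart {α β : Weight k H g} {φ : Module.Dual k g} {v : g}
    (hφ : ∀ γ : Weight k H g, γ ≠ α → ∀ x ∈ rootSpace H γ, φ x = 0) (hv : v ∈ rootSpace H β) :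
    entry (unipotentGroup b) φ v ∈ gradedPart b (weightDeg α - weightDeg β) ∧
    entryInv (unipotentGroup b) φ v ∈ gradedPart b (weightDeg α - weightDeg β) := by
  have aux (χ : AddChar (RootLattice H) k) (t : g ≃ₗ[k] g) (ht : IsTorusElement χ t)
      (u : g ≃ₗ[k] g) :
      φ ((t * u * t⁻¹) v) = χ (weightDeg α - weightDeg β) * φ (u v) := by
    have h1 : φ ∘ₗ t.toLinearMap = χ (weightDeg α) • φ := by
      refine weight_ext (H := H) fun γ x hx => ?_
      rw [LinearMap.comp_apply, LinearMap.smul_apply, LinearEquiv.coe_coe, ht γ x hx, map_smul]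
      by_cases hγ : γ = α
      · rw [hγ]
      · rw [hφ γ hγ x hx, smul_zero, smul_zero]
    have hχ : χ (weightDeg β) * χ (-weightDeg β) = 1 := by
      rw [← AddChar.map_add_eq_mul, add_neg_cancel, AddChar.map_zero_eq_one]
    have h2 : t⁻¹ v = χ (-weightDeg β) • v := by
      refine t.injective ?_
      rw [map_smul, ht β v hv, smul_smul, mul_comm, hχ, one_smul]
      exact t.apply_symm_apply v
    have h3 := LinearMap.congr_fun h1 (u (t⁻¹ v))
    rw [h2, map_smul] at h3
    change φ (t (u (t⁻¹ v))) = _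
    rw [h2, map_smul]
    refine h3.trans ?_
    rw [sub_eq_add_neg, AddChar.map_add_eq_mul, map_smul, LinearMap.smul_apply, smul_eq_mul,
      smul_eq_mul]
    ring
  refine ⟨fun χ t ht u u' h => ?_, fun χ t ht u u' h => ?_⟩
  · rw [entry_apply, entry_apply, h, aux χ t ht]
  · rw [entryInv_apply, entryInv_apply, Subgroup.coe_inv, h, ← aux χ t ht]
    simp [mul_assoc]

lemma dual_mem_span (φ : Module.Dual k g) : φ ∈ Submodule.span k
    {ψ : Module.Dual k g | ∃ α : Weight k H g, ∀ γ : Weight k H g, γ ≠ α →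
      ∀ x ∈ rootSpace H γ, ψ x = 0} := by
  classical
  have := Fintype.ofFinite (Weight k H g)
  choose p hp using fun α : Weight k H g =>
    exists_diagonal (H := H) (g := g) (k := k) (Pi.single α 1)
  have hsum : φ = ∑ α, φ ∘ₗ p α := by
    have h1 : ∑ α, p α = LinearMap.id := weight_ext (H := H) fun γ x hx => by
      rw [LinearMap.sum_apply, Finset.sum_eq_single γ]
      · simp [hp γ γ x hx]
      · intro α _ hα
        simp [hp α γ x hx, Pi.single_eq_of_ne hα.symm]
      · simp
    refine LinearMap.ext fun x => ?_
    have h2 := LinearMap.congr_fun h1 x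
    rw [LinearMap.sum_apply, LinearMap.id_apply] at h2
    rw [LinearMap.sum_apply]
    conv_lhs => rw [← h2, map_sum]
    rfl
  rw [hsum]
  refine Submodule.sum_mem _ fun α _ => Submodule.subset_span ⟨α, fun γ hγ x hx => ?_⟩
  simp [hp α γ x hx, Pi.single_eq_of_ne hγ]

lemma entries_mem_iSup (φ : Module.Dual k g) (v : g) :
    entry (unipotentGroup b) φ v ∈ ⨆ ν, gradedPart b ν ∧
    entryInv (unipotentGroup b) φ v ∈ ⨆ ν, gradedPart b ν := by
  induction dual_mem_span (H := H) φ using Submodule.span_induction with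
  | zero => exact ⟨zero_mem (⨆ ν, gradedPart b ν), zero_mem (⨆ ν, gradedPart b ν)⟩
  | add φ ψ _ _ h h' => exact ⟨add_mem h.1 h'.1, add_mem h.2 h'.2⟩
  | smul c φ _ h => exact ⟨Submodule.smul_mem _ c h.1, Submodule.smul_mem _ c h.2⟩
  | mem φ hφ =>
    obtain ⟨α, hα⟩ := hφ
    have hv : v ∈ ⨆ α : Weight k H g, (rootSpace H α).toSubmodule := by
      rw [iSup_rootSpace_eq_top]; trivial
    induction hv using Submodule.iSup_induction' with
    | zero =>
      have h0 : entry (unipotentGroup b) φ 0 = 0 := coordRing_ext fun u => by simp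
      have h0' : entryInv (unipotentGroup b) φ 0 = 0 := coordRing_ext fun u => by simp
      rw [h0, h0']
      exact ⟨zero_mem _, zero_mem _⟩
    | add x y _ _ h h' =>
      have h0 : entry (unipotentGroup b) φ (x + y) =
        entry (unipotentGroup b) φ x + entry (unipotentGroup b) φ y :=
        coordRing_ext fun u => by simp
      have h0' : entryInv (unipotentGroup b) φ (x + y) =
        entryInv (unipotentGroup b) φ x + entryInv (unipotentGroup b) φ y :=
        coordRing_ext fun u => by simp
      rw [h0, h0']
      exact ⟨add_mem h.1 h'.1, add_mem h.2 h'.2⟩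
    | mem β x hx =>
      have := entry_mem_gradedPart b hα hx
      exact ⟨Submodule.mem_iSup_of_mem _ this.1, Submodule.mem_iSup_of_mem _ this.2⟩

lemma mul_mem_iSup {f f' : ZDelta b} (h : f ∈ ⨆ ν, gradedPart b ν)
    (h' : f' ∈ ⨆ ν, gradedPart b ν) : f * f' ∈ ⨆ ν, gradedPart b ν := by
  induction h using Submodule.iSup_induction' with
  | zero => rw [zero_mul]; exact zero_mem _
  | add x y _ _ hx hy => rw [add_mul]; exact add_mem hx hy
  | mem ν x hx =>
    induction h' using Submodule.iSup_induction' with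
    | zero => rw [mul_zero]; exact zero_mem _
    | add y z _ _ hy hz => rw [mul_add]; exact add_mem hy hz
    | mem ν' y hy => exact Submodule.mem_iSup_of_mem (ν + ν') (mul_mem_gradedPart hx hy)

lemma iSup_gradedPart : ⨆ ν, gradedPart b ν = ⊤ := by
  refine eq_top_iff.2 fun f _ => ?_
  induction f using coordRing_induction with
  | _entry φ v => exact (entries_mem_iSup b φ v).1
  | _entry_inv φ v => exact (entries_mem_iSup b φ v).2
  | _const c =>
    rw [Algebra.algebraMap_eq_smul_one]
    exact Submodule.smul_mem _ c (Submodule.mem_iSup_of_mem 0 (one_mem_gradedPart b))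
  | _add f f' h h' => exact add_mem (h trivial) (h' trivial)
  | _mul f f' h h' =>
    exact mul_mem_iSup b (h trivial) (h' trivial)

open Classical in
/-- The root lattice grading of `Z_Δ`. -/
noncomputable instance : GradedAlgebra (gradedPart b) where
  toDecomposition := DirectSum.IsInternal.chooseDecomposition _
    ⟨gradedPart_coe_injective b, fun f => by
      obtain ⟨x, hx⟩ := (Submodule.mem_iSup_iff_exists_dfinsupp _ f).1
        ((iSup_gradedPart b).symm ▸ Submodule.mem_top : f ∈ ⨆ ν, gradedPart b ν)
      exact ⟨x, hx⟩⟩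

/-- A system of homogeneous polynomial generators `z_β`, `β ∈ Δ₊`, of `Z_Δ`: the degree of `z_β` is
`β`, and `Z_Δ` is the polynomial algebra in the `z_β`. -/
structure IsRootCoordinates (z : PosRoot b → ZDelta b) : Prop where
  mem_gradedPart : ∀ β, z β ∈ gradedPart b β.deg
  algebraicIndependent : AlgebraicIndependent k z
  adjoin_eq_top : Algebra.adjoin k (Set.range z) = ⊤

variable {b}

/-- The ideal `I(B)` generated by the `z_β` with `β ∈ Δ₊ \ B`. -/
def rootIdeal (z : PosRoot b → ZDelta b) (B : Set (PosRoot b)) : Ideal (ZDelta b) :=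
  Ideal.span (z '' Bᶜ)

variable (b)

/-- The poset, under inclusion, of the subsets of `Δ₊` closed by sums. -/
abbrev ClosedSubset : Type _ := {B : Set (PosRoot b) // ClosedBySums B}

open Classical in
/-- The poset, under inclusion, of the Hopf ideals of `Z_Δ` that are homogeneous for the root
lattice grading. -/
abbrev GradedHopfIdeal : Type _ :=
  {I : Ideal (ZDelta b) // I.IsHopfIdeal k ∧ I.IsHomogeneous (gradedPart b)}

end Grading

end RootGrading

end UnipotentCoord

/-!
# Graded Hopf ideals of the coordinate ring of `N₊`

**Coordinates.** Let `h ∈ H` be regular, in the sense that distinct weights of `H` on `g` take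
distinct values at `h`. As `u` runs through `N₊`, the orbit map `u ↦ u h` is a bijection from `N₊`
to `h + n₊`. It is onto because `[x, h]` is a nonzero multiple of `x` for a root vector `x`, so that
a prescribed point of `h + n₊` is reached by correcting the error one height at a time, each
correction being polynomial in the data (`exists_section`). It is one to one because an element
fixing `h` commutes with `ad h`, hence preserves the weight spaces, while it acts unipotently for
the height filtration (`eq_one_of_apply_eq`). The components of `u h` along the root vectors are
therefore homogeneous coordinates on `N₊`, with a polynomial inverse, and `Z_Δ` is the polynomial
algebra in them (`isRootCoordinates_orbitCoord`).

**From closed sets to ideals.** Let `B` be a closed set of positive roots. If a root `β ∉ B` is a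
sum of positive roots, then one of them is outside `B`; hence every monomial of degree `β` contains
a coordinate whose degree is outside `B` (`ClosedBySums.exists_notMem_of_weight_eq`). Applied to the
comultiplication and the antipode of `z_β`, this shows that the points whose coordinates outside `B`
vanish form a subgroup of `N₊`, and `I(B)` is the ideal of functions that vanish on it
(`mem_rootIdeal_iff`, `isHopfIdeal_rootIdeal`).

**From ideals to closed sets.** Let `J` be a graded Hopf ideal and `B` the set of positive roots `γ`
for which the tangent vector `∂_γ` at `1` along `g_γ` kills `J`. Since `[∂_x, ∂_y] = ∂_[x, y]`, and
since `[g_α, g_β] ≠ 0` whenever `α + β` is a root, `B` is closed. For `β ∉ B` some element of `J`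
has degree `β` and a nonzero coefficient at `z_β`; all its other monomials contain a coordinate of
smaller height outside `B`, so induction on the height gives `z_β ∈ J` (`coord_mem`). Conversely,
the invariant derivations `D_γ`, `γ ∈ B`, preserve `J` and lower degrees by `γ`. By induction on the
height of the degree, a homogeneous element `f ∈ J` has all `D_γ f` in `I(B)`. Modulo `I(B)` the
matrix `(D_γ z_β)` for `β, γ ∈ B` is triangular for the height, with nonzero constants on the
diagonal, so all the partial derivatives of `f` vanish modulo `I(B)`; in characteristic zero `f` is
then a constant modulo `I(B)` (`exists_sub_algebraMap_mem`), and the constant is `0` because the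
counit kills `J`. Hence `J = I(B)`.
-/

namespace UnipotentCoord

open scoped TensorProduct
open LieAlgebra LieAlgebra.IsKilling LieModule

section Roots

variable {k g : Type*} [Field k] [CharZero k] [LieRing g] [LieAlgebra k g] [IsKilling k g]
  [FiniteDimensional k g] {H : LieSubalgebra k g} [H.IsCartanSubalgebra]
  [IsTriangularizable k H g] (b : (rootSystem H).Base)

/-! ### Heights and closed sets of positive roots -/

/-- The height of an element of the root lattice, as an additive map: it takes the value `1` on
each simple root. -/
noncomputable def ht : RootLattice H →ₗ[ℤ] ℤ :=
  b.toWeightBasisInt.constr ℤ fun _ => 1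

lemma ht_rootSpanMem (i : H.root) : ht b ((rootSystem H).rootSpanMem ℤ i) = b.height i := by
  obtain ⟨f, -, -, hf⟩ := b.exists_root_eq_sum_int i
  rw [RootPairing.Base.height_eq_sum hf]
  have h1 : (rootSystem H).rootSpanMem ℤ i =
      ∑ j ∈ b.support, f j • (rootSystem H).rootSpanMem ℤ j := by
    refine Subtype.ext ?_
    rw [AddSubmonoidClass.coe_finsetSum]
    exact hf
  rw [h1, map_sum]
  refine Finset.sum_congr rfl fun j hj => ?_
  have h2 : (rootSystem H).rootSpanMem ℤ j = b.toWeightBasisInt ⟨j, hj⟩ :=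
    Subtype.ext (b.coe_toWeightBasisInt_apply ⟨j, hj⟩).symm
  rw [map_smul, h2, ht, Module.Basis.constr_basis]
  simp

variable {b} in
lemma ht_deg_pos (β : PosRoot b) : 0 < ht b β.deg := by
  rw [PosRoot.deg, ht_rootSpanMem]
  exact β.2

variable {b} in
lemma deg_injective : Function.Injective (PosRoot.deg : PosRoot b → RootLattice H) :=
  fun _ _ h => Subtype.ext ((rootSystem H).root.injective (congrArg Subtype.val h))

variable {b} in
lemma deg_ne_zero (β : PosRoot b) : β.deg ≠ 0 := fun h => by
  have := ht_deg_pos β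
  simp [h] at this

/-- A positive root which is a sum of elements of a closed set `B` lies in `B`: one of the
summands pairs positively with the coroot of `β`, so it may be split off. -/
lemma ClosedBySums.mem_of_deg_eq_sum {b : (rootSystem H).Base} {B : Set (PosRoot b)}
    (hB : ClosedBySums B) (s : Multiset (PosRoot b)) (hs : ∀ α ∈ s, α ∈ B) (β : PosRoot b)
    (h : β.deg = (s.map PosRoot.deg).sum) : β ∈ B := by
  induction hn : Multiset.card s generalizing s β with
  | zero =>
    rw [Multiset.card_eq_zero.1 hn] at h
    exact absurd h (by simpa using deg_ne_zero β)
  | succ n ih =>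
    obtain ⟨α, hα, hpos⟩ : ∃ α ∈ s, 0 < (rootSystem H).pairingIn ℤ β.1 α.1 := by
      by_contra! hcon
      have h1 : ∀ α ∈ s, (rootSystem H).pairingIn ℤ α.1 β.1 ≤ 0 := fun α hα => by
        by_contra! h'
        exact absurd (((rootSystem H).zero_lt_pairingIn_iff' ℤ).1 h') (not_lt.2 (hcon α hα))
      have h2 : (rootSystem H).pairingIn ℤ β.1 β.1 =
          (s.map fun α => (rootSystem H).pairingIn ℤ α.1 β.1).sum := by
        apply Int.cast_injective (α := k)
        have h3 := congrArg
          (fun ν : RootLattice H => (rootSystem H).coroot' β.1 (ν : Module.Dual k H)) h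
        have h4 : ∀ t : Multiset (PosRoot b),
            (rootSystem H).coroot' β.1 (((t.map PosRoot.deg).sum : RootLattice H) :
              Module.Dual k H) =
            (((t.map fun α => (rootSystem H).pairingIn ℤ α.1 β.1).sum : ℤ) : k) := by
          intro t
          induction t using Multiset.induction with
          | empty => simp
          | cons a t iht =>
            rw [Multiset.map_cons, Multiset.sum_cons, Multiset.map_cons, Multiset.sum_cons,
              Int.cast_add, ← iht, Submodule.coe_add, map_add]
            congr 1
            have := (rootSystem H).algebraMap_pairingIn ℤ a.1 β.1
            exact (((rootSystem H).root_coroot'_eq_pairing β.1 a.1).trans this.symm)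
        have h5 := h4 {β}
        simp only [Multiset.map_singleton, Multiset.sum_singleton] at h5
        rw [← h5, ← h4 s]
        exact h3
      rw [(rootSystem H).pairingIn_same] at h2
      have h6 : (s.map fun α => (rootSystem H).pairingIn ℤ α.1 β.1).sum ≤ 0 :=
        (Multiset.sum_le_card_nsmul _ 0 fun x hx => by
          obtain ⟨α, hα, rfl⟩ := Multiset.mem_map.1 hx
          exact h1 α hα).trans (smul_zero _).le
      omega
    obtain ⟨t, rfl⟩ := Multiset.exists_cons_of_mem hα
    by_cases hβα : β = α
    · exact hβα ▸ hs α hα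
    obtain ⟨i, hi⟩ := (rootSystem H).root_sub_root_mem_of_pairingIn_pos hpos
      (fun h' => hβα (Subtype.ext h'))
    have hdeg : (rootSystem H).rootSpanMem ℤ i = (t.map PosRoot.deg).sum := by
      have : (rootSystem H).rootSpanMem ℤ i = β.deg - α.deg := Subtype.ext hi
      rw [this, h, Multiset.map_cons, Multiset.sum_cons, add_sub_cancel_left]
    have hipos : b.IsPos i := by
      rw [b.isPos_iff', ← ht_rootSpanMem, hdeg, map_multiset_sum]
      refine Multiset.sum_nonneg fun x hx => ?_
      simp only [Multiset.map_map, Multiset.mem_map] at hx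
      obtain ⟨a, -, rfl⟩ := hx
      exact (ht_deg_pos a).le
    have hγ : (⟨i, hipos⟩ : PosRoot b) ∈ B :=
      ih t (fun a ha => hs a (Multiset.mem_cons_of_mem ha)) ⟨i, hipos⟩ hdeg (by simpa using hn)
    refine hB _ hγ _ (hs α hα) β ?_
    rw [h, Multiset.map_cons, Multiset.sum_cons, ← hdeg, add_comm]
    rfl

end Roots

section Filtration

variable {k g : Type*} [Field k] [CharZero k] [LieRing g] [LieAlgebra k g] [IsKilling k g]
  [FiniteDimensional k g] {H : LieSubalgebra k g} [H.IsCartanSubalgebra]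
  [IsTriangularizable k H g]

/-! ### The height filtration of the Lie algebra -/

open Classical in
/-- The projection of `g` onto the weight space of `α`. -/
noncomputable def weightProj (α : Weight k H g) : g →ₗ[k] g :=
  (exists_diagonal (H := H) (g := g) (k := k) (Pi.single α 1)).choose

lemma weightProj_same {α : Weight k H g} {x : g} (hx : x ∈ rootSpace H α) :
    weightProj α x = x := by
  classical
  have := (exists_diagonal (H := H) (g := g) (k := k) (Pi.single α 1)).choose_spec α x hx
  rw [Pi.single_eq_same, one_smul] at this
  exact this

lemma weightProj_of_ne {α γ : Weight k H g} (h : γ ≠ α) {x : g} (hx : x ∈ rootSpace H γ) :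
    weightProj α x = 0 := by
  classical
  have := (exists_diagonal (H := H) (g := g) (k := k) (Pi.single α 1)).choose_spec γ x hx
  rw [Pi.single_eq_of_ne h, zero_smul] at this
  exact this

lemma weightProj_mem (α : Weight k H g) (x : g) : weightProj α x ∈ rootSpace H α := by
  have hx : x ∈ ⨆ α : Weight k H g, (rootSpace H α).toSubmodule := by
    rw [iSup_rootSpace_eq_top]; trivial
  induction hx using Submodule.iSup_induction' with
  | zero => simp
  | add x y _ _ hx hy => rw [map_add]; exact add_mem hx hy
  | mem γ x hx =>
    by_cases h : γ = α
    · subst h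
      rw [weightProj_same hx]
      exact hx
    · rw [weightProj_of_ne h hx]
      exact zero_mem _

lemma sum_weightProj [Fintype (Weight k H g)] (x : g) : ∑ α : Weight k H g, weightProj α x = x := by
  suffices h : ∑ α : Weight k H g, weightProj α = LinearMap.id by
    simpa using LinearMap.congr_fun h x
  refine weight_ext (H := H) fun γ x hx => ?_
  rw [LinearMap.sum_apply, Finset.sum_eq_single γ (fun α _ h => weightProj_of_ne h.symm hx)
    (by simp), weightProj_same hx, LinearMap.id_apply]

variable (b : (rootSystem H).Base)

/-- The sum of the weight spaces of weights of height at least `m`. -/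
noncomputable def heightFiltration (m : ℤ) : Submodule k g :=
  ⨆ (α : Weight k H g) (_ : m ≤ ht b (weightDeg α)), (rootSpace H α).toSubmodule

variable {b}

lemma mem_heightFiltration {m : ℤ} {α : Weight k H g} (h : m ≤ ht b (weightDeg α)) {x : g}
    (hx : x ∈ rootSpace H α) : x ∈ heightFiltration b m :=
  Submodule.mem_iSup_of_mem α (Submodule.mem_iSup_of_mem h hx)

lemma heightFiltration_induction {m : ℤ} {p : g → Prop} (h0 : p 0)
    (hadd : ∀ x y, p x → p y → p (x + y))
    (hw : ∀ (α : Weight k H g), m ≤ ht b (weightDeg α) → ∀ x ∈ rootSpace H α, p x)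
    {x : g} (hx : x ∈ heightFiltration b m) : p x := by
  refine Submodule.iSup_induction _ (motive := p) hx (fun α x hx => ?_) h0 hadd
  by_cases h : m ≤ ht b (weightDeg α)
  · exact hw α h x (by simpa [h] using hx)
  · simp only [h, iSup_false, Submodule.mem_bot] at hx
    exact hx ▸ h0

lemma heightFiltration_antitone : Antitone (heightFiltration b) := fun _ _ h _ hx =>
  heightFiltration_induction (zero_mem _) (fun _ _ => add_mem)
    (fun _ hα _ hx => mem_heightFiltration (h.trans hα) hx) hx

lemma lie_mem_heightFiltration {m n : ℤ} {x y : g} (hx : x ∈ heightFiltration b m)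
    (hy : y ∈ heightFiltration b n) : ⁅x, y⁆ ∈ heightFiltration b (m + n) := by
  refine heightFiltration_induction (p := fun x => ⁅x, y⁆ ∈ heightFiltration b (m + n)) ?_ ?_ ?_ hx
  · simp
  · intro x x' h h'
    rw [add_lie]
    exact add_mem h h'
  intro α hα x hx
  refine heightFiltration_induction (p := fun y => ⁅x, y⁆ ∈ heightFiltration b (m + n)) ?_ ?_ ?_ hy
  · simp
  · intro x x' h h'
    rw [lie_add]
    exact add_mem h h'
  intro β hβ y hy
  have hxy : ⁅x, y⁆ ∈ rootSpace H (α + β : H → k) :=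
    lie_mem_genWeightSpace_of_mem_genWeightSpace hx hy
  by_cases h0 : rootSpace H (α + β : H → k) = ⊥
  · rw [h0, LieSubmodule.mem_bot] at hxy
    rw [hxy]
    exact zero_mem _
  · refine mem_heightFiltration (α := ⟨(α : H → k) + (β : H → k), h0⟩) ?_ hxy
    have : weightDeg (⟨(α : H → k) + (β : H → k), h0⟩ : Weight k H g) =
        weightDeg α + weightDeg β := rfl
    rw [this, map_add]
    exact add_le_add hα hβ

lemma weightProj_eq_zero_of_mem {m : ℤ} {x : g} (hx : x ∈ heightFiltration b m)
    {α : Weight k H g} (hα : ht b (weightDeg α) < m) : weightProj α x = 0 := by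
  refine heightFiltration_induction (p := fun x => weightProj α x = 0) (map_zero _) ?_ ?_ hx
  · intro x y h h'
    rw [map_add, h, h', add_zero]
  · intro γ hγ x hx
    refine weightProj_of_ne ?_ hx
    rintro rfl
    exact absurd hα (not_lt.2 hγ)

variable (b) in
lemma exists_height_bound : ∃ M : ℕ, heightFiltration b M = ⊥ ∧ heightFiltration b (-M) = ⊤ := by
  have := Fintype.ofFinite (Weight k H g)
  let M : ℕ := ∑ α : Weight k H g, (ht b (weightDeg α)).natAbs + 1
  have hM (α : Weight k H g) : (ht b (weightDeg α)).natAbs < M :=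
    Nat.lt_succ_of_le (Finset.single_le_sum (f := fun α : Weight k H g =>
      (ht b (weightDeg α)).natAbs) (fun _ _ => Nat.zero_le _) (Finset.mem_univ α))
  refine ⟨M, ?_, ?_⟩
  · refine eq_bot_iff.2 fun x hx => heightFiltration_induction (zero_mem _)
      (fun _ _ => add_mem) (fun α hα x _ => ?_) hx
    have := hM α
    omega
  · rw [eq_top_iff, ← iSup_rootSpace_eq_top (H := H), iSup_le_iff]
    intro α x hx
    refine mem_heightFiltration ?_ hx
    have := hM α
    omega

lemma weightDeg_eq_zero {α : Weight k H g} (h : α.IsZero) : weightDeg α = 0 := by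
  refine Subtype.ext ?_
  ext x
  exact congrFun h x

lemma exists_posRoot_of_ht_pos {α : Weight k H g} (h : 0 < ht b (weightDeg α)) :
    ∃ β : PosRoot b, (β.1 : Weight k H g) = α := by
  have hα : ¬ α.IsZero := fun h0 => by
    rw [weightDeg_eq_zero h0] at h
    simp at h
  let i : H.root := ⟨α, by simpa using hα⟩
  refine ⟨⟨i, ?_⟩, rfl⟩
  rw [b.isPos_iff, ← ht_rootSpanMem]
  exact h

variable (b) in
lemma nPlus_eq_heightFiltration : nPlus b = heightFiltration b 1 := by
  refine le_antisymm (iSup_le fun β x hx => mem_heightFiltration ?_ hx) fun x hx =>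
    heightFiltration_induction (zero_mem _) (fun _ _ => add_mem) (fun α hα x hx => ?_) hx
  · rw [weightDeg_posRoot]
    exact ht_deg_pos β
  · obtain ⟨β, rfl⟩ := exists_posRoot_of_ht_pos (b := b) (lt_of_lt_of_le one_pos hα)
    exact Submodule.mem_iSup_of_mem β hx

lemma ad_pow_mem {x : g} {r : ℤ} (hx : x ∈ heightFiltration b r) {m : ℤ} {y : g}
    (hy : y ∈ heightFiltration b m) (n : ℕ) :
    ((ad k g x) ^ n) y ∈ heightFiltration b (m + n * r) := by
  induction n with
  | zero => simpa using hy
  | succ n ih =>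
    rw [pow_succ', Module.End.mul_apply]
    have := lie_mem_heightFiltration hx ih
    rwa [show m + ((n + 1 : ℕ) : ℤ) * r = r + (m + n * r) by push_cast; ring]

variable (b) in
lemma exists_ad_pow_eq_zero : ∃ M : ℕ, ∀ x ∈ nPlus b, (ad k g x) ^ M = 0 := by
  obtain ⟨M, h1, h2⟩ := exists_height_bound b
  refine ⟨2 * M, fun x hx => LinearMap.ext fun y => ?_⟩
  rw [nPlus_eq_heightFiltration] at hx
  have := ad_pow_mem hx (show y ∈ heightFiltration b (-M) from h2 ▸ trivial) (2 * M)
  rw [show -(M : ℤ) + ((2 * M : ℕ) : ℤ) * 1 = M by push_cast; ring, h1] at this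
  simpa using this

end Filtration

/-! ### Exponentials of nilpotent elements -/

section Exp

variable {k g : Type*} [Field k] [LieRing g] [LieAlgebra k g]

lemma expAd_eq_sum {x : g} {n : ℕ} (h : (ad k g x) ^ n = 0) :
    expAd x = ∑ i ∈ Finset.range n, (i.factorial : k)⁻¹ • (ad k g x) ^ i := by
  have hle : nilpotencyClass (ad k g x) ≤ n := csInf_le' h
  rw [expAd]
  refine Finset.sum_subset (Finset.range_mono hle) fun i _ hi => ?_
  rw [pow_eq_zero_of_le (not_lt.1 (by simpa using hi)) (pow_nilpotencyClass ⟨n, h⟩), smul_zero]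

/-- The exponential of a nilpotent `ad x` is a Lie algebra automorphism, with inverse the
exponential of `ad (-x)`. -/
lemma exists_expAd_equiv [CharZero k] {x : g} (h : IsNilpotent (ad k g x)) :
    ∃ u : g ≃ₗ[k] g, (u : g →ₗ[k] g) = expAd x ∧ ((u⁻¹ : g ≃ₗ[k] g) : g →ₗ[k] g) = expAd (-x) ∧
      ∀ y z, u ⁅y, z⁆ = ⁅u y, u z⁆ := by
  let _ : Module ℚ g := Module.compHom g (algebraMap ℚ k)
  have hq (q : ℚ) (y : g) : q • y = (algebraMap ℚ k q) • y := rfl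
  let _ : LieAlgebra ℚ g := { lie_smul := fun q x y => by rw [hq, hq, lie_smul] }
  have hexp (y : g) : IsNilpotent.exp (ad k g y) = expAd y := by
    rw [IsNilpotent.exp, expAd]
    refine Finset.sum_congr rfl fun i _ => LinearMap.ext fun z => ?_
    rw [LinearMap.smul_apply, LinearMap.smul_apply, hq, map_inv₀, map_natCast]
  obtain ⟨D, hD⟩ : ∃ D : LieDerivation k g g, D.toLinearMap = ad k g x :=
    ⟨LieDerivation.ad k g x, LinearMap.ext fun y => by
      simp⟩
  have h' : IsNilpotent D.toLinearMap := hD ▸ h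
  refine ⟨(LieDerivation.exp D h').toLinearEquiv, ?_, LinearMap.ext fun y => ?_,
    fun y z => (LieDerivation.exp D h').map_lie y z⟩
  · rw [← hexp, ← hD]
    exact LieDerivation.exp_apply D h'
  · rw [← hexp, map_neg, ← hD]
    refine (LieDerivation.exp D h').injective ?_
    refine ((LieDerivation.exp D h').toLinearEquiv.apply_symm_apply y).trans ?_
    refine Eq.trans ?_ (LieDerivation.exp_map_apply D h' _).symm
    rw [← Module.End.mul_apply, h'.exp_mul_exp_neg_self, Module.End.one_apply]

end Exp

/-! ### Polynomial families of endomorphisms -/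

section PolynomialFamilies

variable {k ι V : Type*} [Field k] [AddCommGroup V] [Module k V]

/-- A function on the affine space `ι → k` given by a polynomial. -/
def IsPolyFun (f : (ι → k) → k) : Prop :=
  ∃ P : MvPolynomial ι k, ∀ c, f c = MvPolynomial.eval c P

/-- A family of vectors, parametrized by `ι → k`, with polynomial coordinates. -/
def IsPolyVec (f : (ι → k) → V) : Prop :=
  ∀ φ : Module.Dual k V, IsPolyFun fun c => φ (f c)

/-- A family of endomorphisms, parametrized by `ι → k`, with polynomial matrix entries. -/
def IsPolyEnd (F : (ι → k) → Module.End k V) : Prop :=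
  ∀ v, IsPolyVec fun c => F c v

lemma isPolyFun_const (a : k) : IsPolyFun fun _ : ι → k => a := ⟨MvPolynomial.C a, by simp⟩

lemma isPolyFun_coord (i : ι) : IsPolyFun fun c : ι → k => c i := ⟨MvPolynomial.X i, by simp⟩

lemma IsPolyFun.add {f f' : (ι → k) → k} (h : IsPolyFun f) (h' : IsPolyFun f') :
    IsPolyFun fun c => f c + f' c := by
  obtain ⟨P, hP⟩ := h
  obtain ⟨Q, hQ⟩ := h'
  exact ⟨P + Q, fun c => by simp [hP, hQ]⟩

lemma IsPolyFun.mul {f f' : (ι → k) → k} (h : IsPolyFun f) (h' : IsPolyFun f') :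
    IsPolyFun fun c => f c * f' c := by
  obtain ⟨P, hP⟩ := h
  obtain ⟨Q, hQ⟩ := h'
  exact ⟨P * Q, fun c => by simp [hP, hQ]⟩

lemma IsPolyFun.sum {κ : Type*} (s : Finset κ) {f : κ → (ι → k) → k}
    (h : ∀ j ∈ s, IsPolyFun (f j)) : IsPolyFun fun c => ∑ j ∈ s, f j c := by
  classical
  induction s using Finset.induction with
  | empty => simpa using isPolyFun_const (0 : k)
  | insert a s ha ih =>
    simp only [Finset.sum_insert ha]
    exact (h a (Finset.mem_insert_self a s)).add
      (ih fun j hj => h j (Finset.mem_insert_of_mem hj))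

lemma isPolyVec_const (v : V) : IsPolyVec fun _ : ι → k => v := fun φ => isPolyFun_const (φ v)

lemma IsPolyVec.add {f f' : (ι → k) → V} (h : IsPolyVec f) (h' : IsPolyVec f') :
    IsPolyVec fun c => f c + f' c := fun φ => by
  simpa using (h φ).add (h' φ)

lemma IsPolyVec.sum {κ : Type*} (s : Finset κ) {f : κ → (ι → k) → V}
    (h : ∀ j ∈ s, IsPolyVec (f j)) : IsPolyVec fun c => ∑ j ∈ s, f j c := fun φ => by
  simpa using IsPolyFun.sum s fun j hj => h j hj φ

lemma IsPolyVec.map {W : Type*} [AddCommGroup W] [Module k W] {f : (ι → k) → V}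
    (h : IsPolyVec f) (T : V →ₗ[k] W) : IsPolyVec fun c => T (f c) := fun φ => h (φ ∘ₗ T)

lemma IsPolyFun.smul_const {f : (ι → k) → k} (h : IsPolyFun f) (v : V) :
    IsPolyVec fun c => f c • v := fun φ => by
  simpa using h.mul (isPolyFun_const (φ v))

lemma IsPolyEnd.apply [FiniteDimensional k V] {F : (ι → k) → Module.End k V} {f : (ι → k) → V}
    (hF : IsPolyEnd F) (hf : IsPolyVec f) : IsPolyVec fun c => F c (f c) := by
  intro φ
  let e := Module.finBasis k V
  have h : (fun c => φ (F c (f c))) = fun c => ∑ i, e.coord i (f c) * φ (F c (e i)) := by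
    ext c
    conv_lhs => rw [← e.sum_repr (f c), map_sum, map_sum]
    simp
  rw [h]
  exact IsPolyFun.sum _ fun i _ => (hf (e.coord i)).mul (hF (e i) φ)

lemma isPolyEnd_one : IsPolyEnd fun _ : ι → k => (1 : Module.End k V) := fun v => isPolyVec_const v

lemma IsPolyEnd.mul [FiniteDimensional k V] {F G : (ι → k) → Module.End k V}
    (hF : IsPolyEnd F) (hG : IsPolyEnd G) : IsPolyEnd fun c => F c * G c :=
  fun v => hF.apply (hG v)

lemma IsPolyEnd.pow [FiniteDimensional k V] {F : (ι → k) → Module.End k V}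
    (hF : IsPolyEnd F) (n : ℕ) : IsPolyEnd fun c => F c ^ n := by
  induction n with
  | zero => simpa using isPolyEnd_one
  | succ n ih => simpa only [pow_succ] using ih.mul hF

variable {g : Type*} [LieRing g] [LieAlgebra k g] [FiniteDimensional k g]

omit [FiniteDimensional k g] in
lemma IsPolyVec.ad {w : (ι → k) → g} (hw : IsPolyVec w) :
    IsPolyEnd fun c => LieAlgebra.ad k g (w c) := fun v => by
  have h : (fun c => LieAlgebra.ad k g (w c) v) = fun c => (-LieAlgebra.ad k g v) (w c) := by
    ext c
    simp
  rw [h]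
  exact hw.map _

lemma IsPolyVec.expAd {w : (ι → k) → g} (hw : IsPolyVec w) {M : ℕ}
    (hM : ∀ c, (LieAlgebra.ad k g (w c)) ^ M = 0) : IsPolyEnd fun c => expAd (k := k) (w c) := by
  intro v
  have h : (fun c => UnipotentCoord.expAd (k := k) (w c) v) = fun c => ∑ i ∈ Finset.range M,
      ((i.factorial : k)⁻¹ • (LinearMap.id : g →ₗ[k] g)) ((LieAlgebra.ad k g (w c) ^ i) v) := by
    ext c
    rw [expAd_eq_sum (hM c)]
    simp
  rw [h]
  exact IsPolyVec.sum _ fun i _ => (hw.ad.pow i v).map _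

end PolynomialFamilies

section Structure

variable {k g : Type*} [Field k] [CharZero k] [LieRing g] [LieAlgebra k g] [IsKilling k g]
  [FiniteDimensional k g] {H : LieSubalgebra k g} [H.IsCartanSubalgebra]
  [IsTriangularizable k H g] {b : (rootSystem H).Base}

/-! ### Elements of the unipotent group -/

lemma isNilpotent_ad {x : g} (hx : x ∈ nPlus b) : IsNilpotent (ad k g x) := by
  obtain ⟨M, hM⟩ := exists_ad_pow_eq_zero b
  exact ⟨M, hM x hx⟩

/-- The element `exp (ad x)` of the unipotent group, for `x ∈ n₊`. -/
noncomputable def expPos (x : g) (hx : x ∈ nPlus b) : unipotentGroup b :=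
  ⟨(exists_expAd_equiv (isNilpotent_ad hx)).choose,
    Subgroup.subset_closure ⟨x, hx, (exists_expAd_equiv (isNilpotent_ad hx)).choose_spec.1⟩⟩

lemma coe_expPos {x : g} (hx : x ∈ nPlus b) :
    ((expPos x hx : g ≃ₗ[k] g) : g →ₗ[k] g) = expAd x :=
  (exists_expAd_equiv (isNilpotent_ad hx)).choose_spec.1

lemma coe_expPos_inv {x : g} (hx : x ∈ nPlus b) :
    ((((expPos x hx)⁻¹ : unipotentGroup b) : g ≃ₗ[k] g) : g →ₗ[k] g) = expAd (-x) :=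
  (exists_expAd_equiv (isNilpotent_ad hx)).choose_spec.2.1

lemma expPos_apply {x : g} (hx : x ∈ nPlus b) (y : g) :
    (expPos x hx : g ≃ₗ[k] g) y = expAd (k := k) x y :=
  LinearMap.congr_fun (coe_expPos hx) y

lemma expPos_inv_apply {x : g} (hx : x ∈ nPlus b) (y : g) :
    (((expPos x hx)⁻¹ : unipotentGroup b) : g ≃ₗ[k] g) y = expAd (k := k) (-x) y :=
  LinearMap.congr_fun (coe_expPos_inv hx) y

lemma map_lie_of_mem_unipotentGroup {u : g ≃ₗ[k] g} (hu : u ∈ unipotentGroup b) (y z : g) :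
    u ⁅y, z⁆ = ⁅u y, u z⁆ := by
  induction hu using Subgroup.closure_induction generalizing y z with
  | mem u hu =>
    obtain ⟨x, hx, hu⟩ := hu
    obtain ⟨v, hv, -, hlie⟩ := exists_expAd_equiv (isNilpotent_ad hx)
    have : u = v := LinearEquiv.toLinearMap_injective (hu.trans hv.symm)
    exact this ▸ hlie y z
  | one => rfl
  | mul u v _ _ hu hv => rw [LinearEquiv.mul_apply, LinearEquiv.mul_apply, LinearEquiv.mul_apply,
      hv, hu]
  | inv u _ hu =>
    refine u.injective ?_
    have h (y : g) : u (u⁻¹ y) = y := u.apply_symm_apply y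
    rw [h, hu, h, h]

lemma expAd_sub_mem {x : g} (hx : x ∈ nPlus b) {m : ℤ} {y : g} (hy : y ∈ heightFiltration b m) :
    expAd (k := k) x y - y ∈ heightFiltration b (m + 1) := by
  obtain ⟨M, hM⟩ := exists_ad_pow_eq_zero b
  rw [expAd_eq_sum (n := M + 1) (by rw [pow_succ, hM x hx, zero_mul]), Finset.sum_range_succ']
  rw [nPlus_eq_heightFiltration] at hx
  simp only [LinearMap.add_apply, LinearMap.sum_apply, LinearMap.smul_apply, pow_zero,
    Nat.factorial_zero, Nat.cast_one, inv_one, one_smul, Module.End.one_apply,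
    add_sub_cancel_right]
  refine Submodule.sum_mem _ fun i _ => Submodule.smul_mem _ _ ?_
  refine heightFiltration_antitone ?_ (ad_pow_mem hx hy (i + 1))
  push_cast
  linarith

/-- The unipotent group acts unipotently with respect to the height filtration. -/
lemma sub_mem_heightFiltration {u : g ≃ₗ[k] g} (hu : u ∈ unipotentGroup b) {m : ℤ} {y : g}
    (hy : y ∈ heightFiltration b m) : u y - y ∈ heightFiltration b (m + 1) := by
  suffices h : ∀ (m : ℤ), ∀ y ∈ heightFiltration b m, u y - y ∈ heightFiltration b (m + 1) ∧
      u⁻¹ y - y ∈ heightFiltration b (m + 1) from (h m y hy).1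
  have hmul {u v : g ≃ₗ[k] g}
      (hu : ∀ (m : ℤ), ∀ y ∈ heightFiltration b m, u y - y ∈ heightFiltration b (m + 1))
      (hv : ∀ (m : ℤ), ∀ y ∈ heightFiltration b m, v y - y ∈ heightFiltration b (m + 1)) :
      ∀ (m : ℤ), ∀ y ∈ heightFiltration b m, (u * v) y - y ∈ heightFiltration b (m + 1) := by
    intro m y hy
    have h1 := hv m y hy
    have h2 := hu m y hy
    have h3 := heightFiltration_antitone (show m + 1 ≤ m + 1 + 1 by linarith) (hu (m + 1) _ h1)
    have h4 : (u * v) y - y = (u (v y - y) - (v y - y)) + (v y - y) + (u y - y) := by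
      rw [LinearEquiv.mul_apply, map_sub]
      abel
    rw [h4]
    exact add_mem (add_mem h3 h1) h2
  clear hy
  induction hu using Subgroup.closure_induction with
  | mem u hu =>
    obtain ⟨x, hx, hu⟩ := hu
    have hu' : u = expPos x hx := LinearEquiv.toLinearMap_injective (hu.trans (coe_expPos hx).symm)
    subst hu'
    refine fun m y hy => ⟨?_, ?_⟩
    · rw [expPos_apply]
      exact expAd_sub_mem hx hy
    · rw [← Subgroup.coe_inv, expPos_inv_apply]
      exact expAd_sub_mem (neg_mem hx) hy
  | one => intro m y _; simp
  | mul u v _ _ hu hv =>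
    refine fun m y hy => ⟨hmul (fun m y hy => (hu m y hy).1) (fun m y hy => (hv m y hy).1) m y hy,
      ?_⟩
    rw [mul_inv_rev]
    exact hmul (fun m y hy => (hv m y hy).2) (fun m y hy => (hu m y hy).2) m y hy
  | inv u _ hu =>
    refine fun m y hy => ⟨(hu m y hy).2, ?_⟩
    rw [inv_inv]
    exact (hu m y hy).1

/-! ### The orbit of a regular element -/

omit [IsKilling k g] [IsTriangularizable k H g] in
variable (H) in
/-- There is a regular element: at some point of the Cartan subalgebra, distinct weights take
distinct values. -/
lemma exists_regular : ∃ h : H, ∀ α β : Weight k H g, α ≠ β → α h ≠ β h := by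
  obtain ⟨h, hh⟩ := Module.Dual.exists_forall_ne_zero_of_forall_exists
    (fun p : {p : Weight k H g × Weight k H g // p.1 ≠ p.2} => p.1.1.toLinear - p.1.2.toLinear)
    (fun p => by
      by_contra! hcon
      refine p.2 (Weight.ext fun x => ?_)
      simpa [sub_eq_zero] using hcon x)
  refine ⟨h, fun α β hne => ?_⟩
  simpa [sub_eq_zero] using hh ⟨(α, β), hne⟩

lemma weightProj_lie (α : Weight k H g) (h : H) (x : g) :
    weightProj α ⁅(h : g), x⁆ = α h • weightProj α x := by
  have : weightProj α ∘ₗ ad k g (h : g) = α h • weightProj α := by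
    refine weight_ext (H := H) fun γ x hx => ?_
    have h1 : ⁅(h : g), x⁆ = γ h • x := lie_eq_smul_of_mem_rootSpace hx h
    rw [LinearMap.comp_apply, ad_apply, h1, map_smul, LinearMap.smul_apply]
    by_cases hγ : γ = α
    · rw [hγ]
    · rw [weightProj_of_ne hγ hx, smul_zero, smul_zero]
  exact LinearMap.congr_fun this x

/-- The stabilizer of a regular element `h` in the unipotent group is trivial: an element of the
stabilizer preserves the weight spaces, which are the eigenspaces of `ad h`. -/
lemma eq_one_of_apply_eq {h : H} (hh : ∀ α β : Weight k H g, α ≠ β → α h ≠ β h)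
    {u : g ≃ₗ[k] g} (hu : u ∈ unipotentGroup b) (huh : u h = h) : u = 1 := by
  have := Fintype.ofFinite (Weight k H g)
  refine LinearEquiv.toLinearMap_injective (weight_ext (H := H) fun α x hx => ?_)
  change u x = x
  have h1 : ⁅(h : g), u x⁆ = α h • u x := by
    have h2 : ⁅(h : g), x⁆ = α h • x := lie_eq_smul_of_mem_rootSpace hx h
    have h3 := map_lie_of_mem_unipotentGroup hu (h : g) x
    rwa [huh, h2, map_smul, eq_comm] at h3
  have h2 (β : Weight k H g) (hβ : β ≠ α) : weightProj β (u x) = 0 := by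
    have h3 := weightProj_lie β h (u x)
    rw [h1, map_smul, ← sub_eq_zero, ← sub_smul] at h3
    exact (smul_eq_zero.1 h3).resolve_left (sub_ne_zero.2 (hh α β hβ.symm))
  have h3 : weightProj α (u x) = u x := by
    conv_rhs => rw [← sum_weightProj (H := H) (u x)]
    rw [Finset.sum_eq_single α (fun β _ hβ => h2 β hβ) (by simp)]
  have h4 := weightProj_eq_zero_of_mem (α := α)
    (sub_mem_heightFiltration hu (mem_heightFiltration (b := b) le_rfl hx)) (by linarith)
  rw [map_sub, h3, weightProj_same hx, sub_eq_zero] at h4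
  exact h4

lemma exists_rootVec (β : PosRoot b) : ∃ (x : g) (φ : Module.Dual k g),
    x ∈ rootSpace H (β.1 : Weight k H g) ∧ φ x = 1 ∧
      ∀ y, weightProj (β.1 : Weight k H g) y = φ y • x := by
  obtain ⟨x, hx, hx0⟩ := (β.1 : Weight k H g).exists_ne_zero
  obtain ⟨ψ, hψ⟩ : ∃ ψ : Module.Dual k g, ψ x ≠ 0 := by
    by_contra! h
    exact hx0 ((Module.forall_dual_apply_eq_zero_iff k x).1 h)
  have h1 : ∀ y ∈ rootSpace H (β.1 : Weight k H g), ∃ c : k, c • x = y := fun y hy => by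
    simpa using (finrank_eq_one_iff_of_nonzero' ⟨x, hx⟩ (by simpa using hx0)).mp
      (finrank_rootSpace_eq_one _ (LieSubalgebra.isNonZero_coe_root β.1)) ⟨y, hy⟩
  refine ⟨x, (ψ x)⁻¹ • (ψ ∘ₗ weightProj (β.1 : Weight k H g)), hx, ?_, fun y => ?_⟩
  · simp [weightProj_same hx, hψ]
  · obtain ⟨c, hc⟩ := h1 _ (weightProj_mem (β.1 : Weight k H g) y)
    simp [← hc]
    field_simp

/-- A nonzero vector in the root space of `β`. -/
noncomputable def rootVec (β : PosRoot b) : g := (exists_rootVec β).choose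

/-- The linear functional on `g` reading the coefficient of `rootVec β`, which vanishes on the
other weight spaces. -/
noncomputable def rootCoord (β : PosRoot b) : Module.Dual k g :=
  (exists_rootVec β).choose_spec.choose

lemma rootVec_mem (β : PosRoot b) : rootVec β ∈ rootSpace H (β.1 : Weight k H g) :=
  (exists_rootVec β).choose_spec.choose_spec.1

lemma rootCoord_rootVec (β : PosRoot b) : rootCoord β (rootVec β) = 1 :=
  (exists_rootVec β).choose_spec.choose_spec.2.1

lemma weightProj_eq_rootCoord_smul (β : PosRoot b) (y : g) :
    weightProj (β.1 : Weight k H g) y = rootCoord β y • rootVec β :=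
  (exists_rootVec β).choose_spec.choose_spec.2.2 y

lemma rootVec_ne_zero (β : PosRoot b) : rootVec β ≠ 0 := fun h => by
  have := rootCoord_rootVec β
  rw [h, map_zero] at this
  exact zero_ne_one this

lemma rootCoord_eq_zero {β : PosRoot b} {γ : Weight k H g} (h : γ ≠ (β.1 : Weight k H g)) {y : g}
    (hy : y ∈ rootSpace H γ) : rootCoord β y = 0 := by
  have h1 := weightProj_eq_rootCoord_smul β y
  rw [weightProj_of_ne h hy, eq_comm] at h1
  exact (smul_eq_zero.1 h1).resolve_right (rootVec_ne_zero β)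

lemma rootVec_mem_nPlus (β : PosRoot b) : rootVec β ∈ nPlus b :=
  Submodule.mem_iSup_of_mem β (rootVec_mem β)

lemma rootCoord_rootVec_of_ne {β γ : PosRoot b} (h : γ ≠ β) : rootCoord β (rootVec γ) = 0 :=
  rootCoord_eq_zero (fun h' => h (Subtype.ext (Subtype.ext h'))) (rootVec_mem γ)

variable [Fintype (PosRoot b)]

lemma sum_rootCoord_smul {y : g} (hy : y ∈ nPlus b) :
    ∑ β : PosRoot b, rootCoord β y • rootVec β = y := by
  induction hy using Submodule.iSup_induction' with
  | zero => simp
  | add x y _ _ hx hy => simp only [map_add, add_smul, Finset.sum_add_distrib, hx, hy]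
  | mem γ y hy =>
    rw [Finset.sum_eq_single γ (fun β _ hβ => ?_) (by simp), ← weightProj_eq_rootCoord_smul,
      weightProj_same hy]
    rw [rootCoord_eq_zero (fun h' => hβ.symm (Subtype.ext (Subtype.ext h'))) hy, zero_smul]

lemma rootCoord_sum (c : PosRoot b → k) (γ : PosRoot b) :
    rootCoord γ (∑ β : PosRoot b, c β • rootVec β) = c γ := by
  rw [map_sum, Finset.sum_eq_single γ (fun β _ hβ => ?_) (by simp), map_smul, rootCoord_rootVec,
    smul_eq_mul, mul_one]
  rw [map_smul, rootCoord_rootVec_of_ne hβ, smul_zero]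

end Structure

lemma aeval_apply {k V ι : Type*} [Field k] [AddCommGroup V] [Module k V]
    {N : Subgroup (V ≃ₗ[k] V)} (z : ι → CoordRing N) (P : MvPolynomial ι k) (u : N) :
    (MvPolynomial.aeval z P : CoordRing N) u = MvPolynomial.eval (fun i => z i u) P := by
  have : (evalAt N u).comp (MvPolynomial.aeval z) = MvPolynomial.aeval fun i => z i u :=
    MvPolynomial.algHom_ext fun i => by simp
  exact AlgHom.congr_fun this P

section Coordinates

variable {k g : Type*} [Field k] [CharZero k] [LieRing g] [LieAlgebra k g] [IsKilling k g]
  [FiniteDimensional k g] {H : LieSubalgebra k g} [H.IsCartanSubalgebra]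
  [IsTriangularizable k H g] {b : (rootSystem H).Base}

/-! ### Coordinates from the orbit of a regular element -/

omit [CharZero k] [IsKilling k g] [IsTriangularizable k H g] in
lemma mem_rootSpace_zero (h : H) : (h : g) ∈ rootSpace H (0 : H → k) := by
  rw [rootSpace_zero_eq]
  exact (LieSubalgebra.mem_toLieSubmodule _).2 h.2

lemma nontrivial_of_posRoot (β : PosRoot b) : Nontrivial g := ⟨rootVec β, 0, rootVec_ne_zero β⟩

lemma posRoot_ne_zero [Nontrivial g] (β : PosRoot b) : (0 : Weight k H g) ≠ β.1 := fun h =>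
  LieSubalgebra.isNonZero_coe_root β.1 (h ▸ Weight.isZero_zero)

lemma rootCoord_cartan (β : PosRoot b) (h : H) : rootCoord β (h : g) = 0 := by
  have := nontrivial_of_posRoot β
  exact rootCoord_eq_zero (γ := 0) (posRoot_ne_zero β) (mem_rootSpace_zero h)

lemma posRoot_apply_ne_zero {h : H} (hh : ∀ α β : Weight k H g, α ≠ β → α h ≠ β h)
    (β : PosRoot b) : (β.1 : Weight k H g) h ≠ 0 := by
  have := nontrivial_of_posRoot β
  simpa using (hh 0 β.1 (posRoot_ne_zero β)).symm

lemma weightProj_mem_heightFiltration {m : ℤ} {y : g} (hy : y ∈ heightFiltration b m)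
    (α : Weight k H g) : weightProj α y ∈ heightFiltration b m := by
  refine heightFiltration_induction (p := fun y => weightProj α y ∈ heightFiltration b m)
    (by simp) (fun x y hx hy => by rw [map_add]; exact add_mem hx hy) (fun γ hγ x hx => ?_) hy
  by_cases h : γ = α
  · subst h
    rw [weightProj_same hx]
    exact mem_heightFiltration hγ hx
  · rw [weightProj_of_ne h hx]
    exact zero_mem _

variable [Fintype (PosRoot b)]

variable (b) in
/-- For a regular element `h` of the Cartan subalgebra, the inverse on `n₊` of `x ↦ ⁅x, h⁆`,
extended by zero to the other weight spaces. -/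
noncomputable def adInv (h : H) : g →ₗ[k] g :=
  ∑ β : PosRoot b, (-((β.1 : Weight k H g) h)⁻¹) • (rootCoord β).smulRight (rootVec β)

lemma adInv_apply (h : H) (y : g) :
    adInv b h y = ∑ β : PosRoot b,
      (-((β.1 : Weight k H g) h)⁻¹) • weightProj (β.1 : Weight k H g) y := by
  rw [adInv, LinearMap.sum_apply]
  exact Finset.sum_congr rfl fun β _ => by
    rw [weightProj_eq_rootCoord_smul, LinearMap.smul_apply, LinearMap.smulRight_apply]

lemma adInv_mem {m : ℤ} {y : g} (h : H) (hy : y ∈ heightFiltration b m) :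
    adInv b h y ∈ heightFiltration b m := by
  rw [adInv_apply]
  exact Submodule.sum_mem _ fun β _ => Submodule.smul_mem _ _ (weightProj_mem_heightFiltration hy _)

lemma adInv_mem_nPlus (h : H) (y : g) : adInv b h y ∈ nPlus b := by
  rw [adInv_apply]
  exact Submodule.sum_mem _ fun β _ => Submodule.smul_mem _ _
    (Submodule.mem_iSup_of_mem β (weightProj_mem _ _))

lemma adInv_cartan (h h' : H) : adInv b h (h' : g) = 0 := by
  rw [adInv_apply]
  refine Finset.sum_eq_zero fun β _ => ?_
  rw [weightProj_eq_rootCoord_smul, rootCoord_cartan, zero_smul, smul_zero]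

lemma adInv_lie {h : H} (hh : ∀ α β : Weight k H g, α ≠ β → α h ≠ β h) {y : g}
    (hy : y ∈ nPlus b) : ⁅adInv b h y, (h : g)⁆ = y := by
  rw [adInv_apply]
  conv_rhs => rw [← sum_rootCoord_smul hy]
  rw [← lie_skew, lie_sum, ← Finset.sum_neg_distrib]
  refine Finset.sum_congr rfl fun β _ => ?_
  have h1 : ⁅(h : g), rootVec β⁆ = (β.1 : Weight k H g) h • rootVec β :=
    lie_eq_smul_of_mem_rootSpace (rootVec_mem β) h
  have h2 := posRoot_apply_ne_zero hh β
  rw [weightProj_eq_rootCoord_smul, lie_smul, lie_smul, h1, smul_smul, smul_smul, ← neg_smul]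
  congr 1
  field_simp

/-- One step of the successive approximation: if `d ∈ n₊` has height at least `m ≥ 1`, then
applying the inverse of `exp (ad (adInv d))` to `h + d` leaves an error of height at least
`m + 1`. -/
lemma expAd_neg_adInv_sub_mem {h : H} (hh : ∀ α β : Weight k H g, α ≠ β → α h ≠ β h) {m : ℤ}
    (hm : 1 ≤ m) {d : g} (hd : d ∈ heightFiltration b m) :
    expAd (k := k) (-adInv b h d) (h + d) - h ∈ heightFiltration b (m + 1) := by
  obtain ⟨M, hM⟩ := exists_ad_pow_eq_zero b
  have hd1 : d ∈ nPlus b := by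
    rw [nPlus_eq_heightFiltration]
    exact heightFiltration_antitone hm hd
  set w := -adInv b h d with hw
  have hwF : w ∈ heightFiltration b m := neg_mem (adInv_mem h hd)
  have hw1 : w ∈ nPlus b := neg_mem (adInv_mem_nPlus h d)
  have hwh : ⁅w, (h : g) + d⁆ = -d + ⁅w, d⁆ := by
    rw [lie_add, hw, neg_lie, adInv_lie hh hd1]
  have hwd : ⁅w, d⁆ ∈ heightFiltration b (m + 1) :=
    heightFiltration_antitone (by linarith) (lie_mem_heightFiltration hwF hd)
  have hv : -d + ⁅w, d⁆ ∈ heightFiltration b m :=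
    add_mem (neg_mem hd) (heightFiltration_antitone (by linarith) hwd)
  rw [expAd_eq_sum (n := M + 2) (by rw [pow_add, hM w hw1, zero_mul]), Finset.sum_range_succ',
    Finset.sum_range_succ']
  have hsum : (∑ i ∈ Finset.range M, ((i + 1 + 1).factorial : k)⁻¹ • ad k g w ^ (i + 1 + 1))
      ((h : g) + d) ∈ heightFiltration b (m + 1) := by
    rw [LinearMap.sum_apply]
    refine Submodule.sum_mem _ fun i _ => Submodule.smul_mem _ _ ?_
    rw [pow_succ, Module.End.mul_apply, ad_apply, hwh]
    refine heightFiltration_antitone ?_ (ad_pow_mem hwF hv (i + 1))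
    push_cast
    nlinarith
  have heq : ∀ A : Module.End k g, (A + ((0 + 1).factorial : k)⁻¹ • ad k g w ^ (0 + 1) +
      ((0).factorial : k)⁻¹ • ad k g w ^ 0) ((h : g) + d) - h = A ((h : g) + d) + ⁅w, d⁆ := by
    intro A
    simp only [LinearMap.add_apply, zero_add, pow_one, pow_zero,
      Nat.factorial_one, Nat.factorial_zero, Nat.cast_one, inv_one, one_smul, ad_apply, hwh,
      Module.End.one_apply]
    abel
  rw [heq]
  exact add_mem hsum hwd

/-- The orbit map of a regular element `h` has a polynomial section over `h + n₊`, up to an error of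
height greater than `m`. -/
lemma exists_approx_section {h : H} (hh : ∀ α β : Weight k H g, α ≠ β → α h ≠ β h) (m : ℕ) :
    ∃ W : (PosRoot b → k) → unipotentGroup b,
      IsPolyEnd (fun c => ((W c : g ≃ₗ[k] g) : g →ₗ[k] g)) ∧
      IsPolyEnd (fun c => ((((W c)⁻¹ : unipotentGroup b) : g ≃ₗ[k] g) : g →ₗ[k] g)) ∧
      ∀ c, (((W c)⁻¹ : unipotentGroup b) : g ≃ₗ[k] g) (h + ∑ β, c β • rootVec β) - h ∈
        heightFiltration b (m + 1) := by
  induction m with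
  | zero =>
    refine ⟨fun _ => 1, isPolyEnd_one, by simpa only [inv_one] using! isPolyEnd_one, fun c => ?_⟩
    simp only [inv_one, Subgroup.coe_one, LinearEquiv.coe_one, id_eq, add_sub_cancel_left]
    rw [Nat.cast_zero, zero_add, ← nPlus_eq_heightFiltration]
    exact Submodule.sum_mem _ fun β _ => Submodule.smul_mem _ _ (rootVec_mem_nPlus β)
  | succ m ih =>
    obtain ⟨W, hW, hW', hWm⟩ := ih
    obtain ⟨M, hM⟩ := exists_ad_pow_eq_zero b
    let y (c : PosRoot b → k) : g := h + ∑ β, c β • rootVec β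
    have hy : IsPolyVec y := (isPolyVec_const (h : g)).add
      (IsPolyVec.sum _ fun β _ => (isPolyFun_coord β).smul_const (rootVec β))
    let f (c : PosRoot b → k) : g := (((W c)⁻¹ : unipotentGroup b) : g ≃ₗ[k] g) (y c)
    have hf : IsPolyVec f := hW'.apply hy
    let w (c : PosRoot b → k) : g := adInv b h (f c)
    have hw : IsPolyVec w := hf.map _
    have hwn (c : PosRoot b → k) : w c ∈ nPlus b := adInv_mem_nPlus h (f c)
    refine ⟨fun c => W c * expPos (w c) (hwn c), ?_, ?_, fun c => ?_⟩
    · have h1 := hW.mul (hw.expAd fun c => hM _ (hwn c))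
      intro v
      convert! h1 v using 2 with c
      rw [Module.End.mul_apply, ← expPos_apply (hwn c)]
      rfl
    · have hw' : IsPolyVec fun c => -w c := by
        simpa using hw.map (-LinearMap.id)
      have h1 := (hw'.expAd fun c => hM _ (neg_mem (hwn c))).mul hW'
      intro v
      convert! h1 v using 2 with c
      rw [Module.End.mul_apply, ← expPos_inv_apply (hwn c)]
      beta_reduce
      rw [mul_inv_rev]
      rfl
    · have hd : f c - h ∈ heightFiltration b (m + 1) := hWm c
      have h1 := expAd_neg_adInv_sub_mem hh (by linarith) hd
      have h2 : adInv b h (f c - h) = w c := by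
        rw [map_sub, adInv_cartan, sub_zero]
      rw [h2, add_sub_cancel, ← expPos_inv_apply (hwn c)] at h1
      rw [mul_inv_rev]
      push_cast
      exact h1

/-- The orbit map `u ↦ u h` of a regular element `h` has a polynomial section over `h + n₊`. -/
lemma exists_section {h : H} (hh : ∀ α β : Weight k H g, α ≠ β → α h ≠ β h) :
    ∃ W : (PosRoot b → k) → unipotentGroup b,
      IsPolyEnd (fun c => ((W c : g ≃ₗ[k] g) : g →ₗ[k] g)) ∧
      IsPolyEnd (fun c => ((((W c)⁻¹ : unipotentGroup b) : g ≃ₗ[k] g) : g →ₗ[k] g)) ∧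
      ∀ c, (W c : g ≃ₗ[k] g) h = h + ∑ β, c β • rootVec β := by
  obtain ⟨M, hM, -⟩ := exists_height_bound b
  obtain ⟨W, hW, hW', hWm⟩ := exists_approx_section (b := b) hh M
  refine ⟨W, hW, hW', fun c => ?_⟩
  have h1 := heightFiltration_antitone (by linarith : (M : ℤ) ≤ M + 1) (hWm c)
  rw [hM, Submodule.mem_bot, sub_eq_zero] at h1
  conv_lhs => rw [← h1]
  exact (W c : g ≃ₗ[k] g).apply_symm_apply _

/-- The family of coordinates `u ↦ rootCoord β (u h)`, for a regular element `h`. -/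
noncomputable def orbitCoord (h : H) (β : PosRoot b) : ZDelta b :=
  entry (unipotentGroup b) (rootCoord β) (h : g)

lemma apply_eq_add_sum_orbitCoord (h : H) (u : unipotentGroup b) :
    (u : g ≃ₗ[k] g) h = h + ∑ β : PosRoot b, orbitCoord h β u • rootVec β := by
  have h1 : (u : g ≃ₗ[k] g) h - h ∈ nPlus b := by
    rcases isEmpty_or_nonempty (Weight k H g) with h0 | h0
    · have : (⊤ : Submodule k g) = ⊥ := by
        rw [← iSup_rootSpace_eq_top (H := H), iSup_of_empty]
      have h2 : (u : g ≃ₗ[k] g) h - h ∈ (⊥ : Submodule k g) := this ▸ Submodule.mem_top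
      rw [(Submodule.mem_bot k).1 h2]
      exact zero_mem _
    · have : Nontrivial g := by
        obtain ⟨α⟩ := h0
        obtain ⟨x, -, hx⟩ := α.exists_ne_zero
        exact ⟨x, 0, hx⟩
      rw [nPlus_eq_heightFiltration]
      have h2 : (h : g) ∈ heightFiltration b 0 := by
        refine mem_heightFiltration (α := 0) ?_ (mem_rootSpace_zero h)
        rw [weightDeg_eq_zero Weight.isZero_zero, map_zero]
      simpa using sub_mem_heightFiltration u.2 h2
  have h2 := sum_rootCoord_smul h1
  simp only [map_sub, rootCoord_cartan, sub_zero] at h2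
  rw [← sub_eq_iff_eq_add', ← h2]
  rfl

omit [Fintype (PosRoot b)] in
theorem isRootCoordinates_orbitCoord {h : H} (hh : ∀ α β : Weight k H g, α ≠ β → α h ≠ β h) :
    IsRootCoordinates b (orbitCoord (b := b) h) := by
  have := Fintype.ofFinite (PosRoot b)
  obtain ⟨W, hW, hW', hWh⟩ := exists_section (b := b) hh
  have heval (P : MvPolynomial (PosRoot b) k) (u : unipotentGroup b) :=
    aeval_apply (orbitCoord (b := b) h) P u
  refine ⟨fun β => ?_, ?_, ?_⟩
  · have := nontrivial_of_posRoot β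
    have h1 := (entry_mem_gradedPart b (φ := rootCoord β) (v := (h : g)) (α := β.1) (β := 0)
      (fun γ hγ x hx => rootCoord_eq_zero hγ hx) (mem_rootSpace_zero h)).1
    rwa [weightDeg_eq_zero Weight.isZero_zero, sub_zero, weightDeg_posRoot] at h1
  · refine (injective_iff_map_eq_zero _).2 fun P hP => MvPolynomial.funext fun c => ?_
    have h1 := heval P (W c)
    rw [hP, zero_apply] at h1
    have h2 : (fun β => orbitCoord h β (W c)) = c := by
      ext β
      rw [orbitCoord, entry_apply, hWh, map_add, rootCoord_cartan, zero_add, rootCoord_sum]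
    rw [map_zero, h1, h2]
  · have hu (u : unipotentGroup b) : W (fun β => orbitCoord h β u) = u := by
      refine inv_mul_eq_one.1 (Subtype.ext (eq_one_of_apply_eq hh (Subtype.mem _) ?_))
      rw [Subgroup.coe_mul, LinearEquiv.mul_apply, apply_eq_add_sum_orbitCoord, ← hWh]
      exact (W _ : g ≃ₗ[k] g).symm_apply_apply _
    rw [← MvPolynomial.aeval_range]
    refine eq_top_iff.2 fun f _ => ?_
    induction f using coordRing_induction with
    | _entry φ v =>
      obtain ⟨P, hP⟩ := hW v φ
      refine ⟨P, coordRing_ext fun u => ?_⟩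
      refine (heval P u).trans ((hP _).symm.trans ?_)
      simp only [hu]
      rfl
    | _entry_inv φ v =>
      obtain ⟨P, hP⟩ := hW' v φ
      refine ⟨P, coordRing_ext fun u => ?_⟩
      refine (heval P u).trans ((hP _).symm.trans ?_)
      simp only [hu]
      rfl
    | _const c => exact Subalgebra.algebraMap_mem _ c
    | _add f f' h h' => exact add_mem (h trivial) (h' trivial)
    | _mul f f' h h' => exact mul_mem (h trivial) (h' trivial)

omit [Fintype (PosRoot b)] in
variable (b) in
theorem exists_isRootCoordinates : ∃ z : PosRoot b → ZDelta b, IsRootCoordinates b z := by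
  obtain ⟨h, hh⟩ := exists_regular (k := k) (g := g) H
  exact ⟨_, isRootCoordinates_orbitCoord hh⟩

end Coordinates

section Points

variable {k g : Type*} [Field k] [CharZero k] [LieRing g] [LieAlgebra k g] [IsKilling k g]
  [FiniteDimensional k g] {H : LieSubalgebra k g} [H.IsCartanSubalgebra]
  [IsTriangularizable k H g] {b : (rootSystem H).Base}

/-! ### Points and homogeneous polynomials in root coordinates -/

omit [CharZero k] in
lemma addChar_weight {A σ : Type*} [AddCommMonoid A] (χ : AddChar A k) (w : σ → A) (d : σ →₀ ℕ) :
    χ (Finsupp.weight w d) = d.prod fun i n => χ (w i) ^ n := by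
  induction d using Finsupp.induction_linear with
  | zero => simp [AddChar.map_zero_eq_one]
  | add d d' h h' =>
    rw [map_add, AddChar.map_add_eq_mul, h, h',
      Finsupp.prod_add_index' (fun _ => pow_zero _) fun _ _ _ => pow_add _ _ _]
  | single i n => simp [Finsupp.weight_apply, AddChar.map_nsmul_eq_pow]

/-- A polynomial on which the characters of the root lattice act through `ν` is homogeneous of
degree `ν`. -/
lemma isWeightedHomogeneous_of_addChar {σ : Type*} (w : σ → RootLattice H) (P : MvPolynomial σ k)
    (ν : RootLattice H) (h : ∀ (χ : AddChar (RootLattice H) k) (c : σ → k),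
      MvPolynomial.eval (fun i => χ (w i) * c i) P = χ ν * MvPolynomial.eval c P) :
    P.IsWeightedHomogeneous w ν := by
  classical
  intro m hm
  refine evalChar_injective (k := k) (MonoidHom.ext fun χ => ?_)
  have hcoeff (Q : MvPolynomial σ k) :
      (MvPolynomial.aeval (fun i => MvPolynomial.C (χ (w i)) * MvPolynomial.X i) Q).coeff m =
        χ (Finsupp.weight w m) * Q.coeff m := by
    induction Q using MvPolynomial.induction_on' with
    | monomial d a =>
      have h1 : MvPolynomial.aeval
          (fun i => MvPolynomial.C (χ (w i)) * MvPolynomial.X i : σ → MvPolynomial σ k)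
          (MvPolynomial.monomial d a) =
          MvPolynomial.C (χ (Finsupp.weight w d)) * MvPolynomial.monomial d a := by
        rw [MvPolynomial.aeval_monomial, Finsupp.prod]
        simp only [mul_pow, Finset.prod_mul_distrib]
        rw [MvPolynomial.monomial_eq, addChar_weight, Finsupp.prod, Finsupp.prod, map_prod]
        simp only [map_pow, MvPolynomial.algebraMap_eq]
        ring
      rw [h1, MvPolynomial.coeff_C_mul, MvPolynomial.coeff_monomial]
      by_cases hd : d = m
      · rw [hd]
      · simp [hd]
    | add p q hp hq => rw [map_add, MvPolynomial.coeff_add, hp, hq, MvPolynomial.coeff_add, mul_add]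
  have h2 : MvPolynomial.aeval
      (fun i => MvPolynomial.C (χ (w i)) * MvPolynomial.X i : σ → MvPolynomial σ k) P =
        MvPolynomial.C (χ ν) * P := by
    refine MvPolynomial.funext fun c => ?_
    rw [map_mul, MvPolynomial.eval_C, ← h χ c]
    have h3 : (MvPolynomial.aeval c).comp (MvPolynomial.aeval
        (fun i => MvPolynomial.C (χ (w i)) * MvPolynomial.X i : σ → MvPolynomial σ k)) =
        MvPolynomial.aeval fun i => χ (w i) * c i :=
      MvPolynomial.algHom_ext fun i => by simp
    exact AlgHom.congr_fun h3 P
  have h4 := hcoeff P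
  rw [h2, MvPolynomial.coeff_C_mul] at h4
  exact (mul_right_cancel₀ hm h4).symm

lemma deg_sum_toMultiset_map {σ : Type*} (r : σ → PosRoot b) (d : σ →₀ ℕ) :
    ((d.toMultiset.map r).map PosRoot.deg).sum = Finsupp.weight (fun i => (r i).deg) d := by
  rw [Finsupp.weight_apply, Multiset.map_map]
  induction d using Finsupp.induction_linear with
  | zero => simp
  | add d d' h h' =>
    rw [map_add, Multiset.map_add, Multiset.sum_add, h, h', Finsupp.sum_add_index'] <;>
    simp [add_smul]
  | single i n =>
    rw [Finsupp.toMultiset_single, Multiset.map_nsmul, Multiset.sum_nsmul]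
    simp

/-- A monomial whose degree is a root `β` outside the closed set `B` involves a variable
outside `B`. -/
lemma ClosedBySums.exists_notMem_of_weight_eq {B : Set (PosRoot b)} (hB : ClosedBySums B)
    {β : PosRoot b} (hβ : β ∉ B) {σ : Type*} (r : σ → PosRoot b) {d : σ →₀ ℕ}
    (hd : Finsupp.weight (fun i => (r i).deg) d = β.deg) : ∃ i ∈ d.support, r i ∉ B := by
  by_contra! hcon
  refine hβ (hB.mem_of_deg_eq_sum (d.toMultiset.map r) (fun α hα => ?_) β ?_)
  · obtain ⟨i, hi, rfl⟩ := Multiset.mem_map.1 hα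
    exact hcon i ((Finsupp.mem_toMultiset d i).1 hi)
  · rw [deg_sum_toMultiset_map, hd]

/-- A homogeneous polynomial whose degree is a root outside the closed set `B` vanishes where all
variables outside `B` do. -/
lemma ClosedBySums.eval_eq_zero {B : Set (PosRoot b)} (hB : ClosedBySums B)
    {β : PosRoot b} (hβ : β ∉ B) {σ : Type*} (r : σ → PosRoot b) {P : MvPolynomial σ k}
    (hP : P.IsWeightedHomogeneous (fun i => (r i).deg) β.deg) {c : σ → k}
    (hc : ∀ i, r i ∉ B → c i = 0) : MvPolynomial.eval c P = 0 := by
  rw [MvPolynomial.eval_eq]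
  refine Finset.sum_eq_zero fun d hd => ?_
  obtain ⟨i, hi, hiB⟩ := hB.exists_notMem_of_weight_eq hβ r (hP (MvPolynomial.mem_support_iff.1 hd))
  rw [Finset.prod_eq_zero hi, mul_zero]
  rw [hc i hiB, zero_pow (Finsupp.mem_support_iff.1 hi)]

/-- Every character of `Z_Δ` is the evaluation at a point of the unipotent group. -/
lemma exists_evalAt_eq (ψ : ZDelta b →ₐ[k] k) : ∃ u, evalAt (unipotentGroup b) u = ψ := by
  have := Fintype.ofFinite (PosRoot b)
  obtain ⟨h, hh⟩ := exists_regular (k := k) (g := g) H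
  obtain ⟨W, -, -, hWh⟩ := exists_section (b := b) hh
  have hz := isRootCoordinates_orbitCoord (b := b) hh
  refine ⟨W fun β => ψ (orbitCoord h β), AlgHom.ext_of_adjoin_eq_top hz.adjoin_eq_top ?_⟩
  rintro _ ⟨β, rfl⟩
  rw [evalAt_apply, orbitCoord, entry_apply, hWh, map_add, rootCoord_cartan, zero_add,
    rootCoord_sum]
  rfl

namespace IsRootCoordinates

variable {z : PosRoot b → ZDelta b} (hz : IsRootCoordinates b z)
include hz

lemma exists_aeval_eq (f : ZDelta b) :
    ∃ P : MvPolynomial (PosRoot b) k, MvPolynomial.aeval z P = f := by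
  have h : f ∈ Algebra.adjoin k (Set.range z) := hz.adjoin_eq_top ▸ Algebra.mem_top
  rwa [← MvPolynomial.aeval_range] at h

/-- Root coordinates identify the unipotent group with an affine space. -/
lemma exists_point (c : PosRoot b → k) : ∃ u : unipotentGroup b, ∀ β, z β u = c β := by
  let e := AlgEquiv.ofBijective (MvPolynomial.aeval z) ⟨hz.algebraicIndependent, hz.exists_aeval_eq⟩
  obtain ⟨u, hu⟩ := exists_evalAt_eq ((MvPolynomial.aeval c).comp e.symm.toAlgHom)
  refine ⟨u, fun β => ?_⟩
  rw [← evalAt_apply, hu]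
  have h : e.symm (z β) = MvPolynomial.X β := by
    rw [AlgEquiv.symm_apply_eq]
    exact (MvPolynomial.aeval_X z β).symm
  simp [h]

lemma apply_conj {χ : AddChar (RootLattice H) k} {t : g ≃ₗ[k] g} (ht : IsTorusElement χ t)
    (u : unipotentGroup b) (β : PosRoot b) :
    z β ⟨t * u * t⁻¹, ht.conj_mem u.2⟩ = χ β.deg * z β u :=
  hz.mem_gradedPart β χ t ht u _ rfl

/-- In root coordinates, an element of degree `ν` is a homogeneous polynomial of degree `ν`. -/
lemma isWeightedHomogeneous {ν : RootLattice H} {P : MvPolynomial (PosRoot b) k}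
    (hP : MvPolynomial.aeval z P ∈ gradedPart b ν) : P.IsWeightedHomogeneous PosRoot.deg ν := by
  refine isWeightedHomogeneous_of_addChar _ P ν fun χ c => ?_
  obtain ⟨u, hu⟩ := hz.exists_point c
  obtain ⟨t, ht⟩ := exists_torusElement χ
  have h := hP χ t ht u ⟨t * u * t⁻¹, ht.conj_mem u.2⟩ rfl
  rw [aeval_apply, aeval_apply] at h
  simpa only [hz.apply_conj ht, hu] using h

lemma apply_one (β : PosRoot b) : z β 1 = 0 := by
  obtain ⟨χ, hχ⟩ := exists_addChar_ne_one (k := k) (deg_ne_zero β)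
  obtain ⟨t, ht⟩ := exists_torusElement χ
  have h := hz.mem_gradedPart β χ t ht 1 1 (by simp)
  have h1 : (1 - χ β.deg) * z β 1 = 0 := by
    linear_combination h
  exact (mul_eq_zero.1 h1).resolve_left (sub_ne_zero.2 hχ.symm)

/-- The group law is polynomial in root coordinates. -/
lemma exists_eval_mul (f : ZDelta b) : ∃ G : MvPolynomial (PosRoot b ⊕ PosRoot b) k,
    ∀ u w : unipotentGroup b, f (u * w) =
      MvPolynomial.eval (Sum.elim (fun β => z β u) fun β => z β w) G := by
  suffices h : ∀ t : ZDelta b ⊗[k] ZDelta b, ∃ G : MvPolynomial (PosRoot b ⊕ PosRoot b) k,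
      ∀ u w : unipotentGroup b, toFun₂ (unipotentGroup b) t (u, w) =
        MvPolynomial.eval (Sum.elim (fun β => z β u) fun β => z β w) G by
    obtain ⟨G, hG⟩ := h (comulHom (unipotentGroup b) f)
    exact ⟨G, fun u w => by rw [← hG, toFun₂_comulHom]⟩
  intro t
  induction t with
  | zero => exact ⟨0, by simp⟩
  | add x y hx hy =>
    obtain ⟨G, hG⟩ := hx
    obtain ⟨G', hG'⟩ := hy
    exact ⟨G + G', fun u w => by rw [map_add, Pi.add_apply, hG, hG', map_add]⟩
  | tmul x y =>
    obtain ⟨P, rfl⟩ := hz.exists_aeval_eq x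
    obtain ⟨Q, rfl⟩ := hz.exists_aeval_eq y
    refine ⟨MvPolynomial.rename Sum.inl P * MvPolynomial.rename Sum.inr Q, fun u w => ?_⟩
    rw [toFun₂_tmul, map_mul, MvPolynomial.eval_rename, MvPolynomial.eval_rename, aeval_apply,
      aeval_apply, Sum.elim_comp_inl, Sum.elim_comp_inr]

/-! ### The Hopf ideals attached to closed sets of roots -/

lemma apply_mul_eq_zero {B : Set (PosRoot b)} (hB : ClosedBySums B) {u w : unipotentGroup b}
    (hu : ∀ β ∉ B, z β u = 0) (hw : ∀ β ∉ B, z β w = 0) : ∀ β ∉ B, z β (u * w) = 0 := by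
  intro β hβ
  obtain ⟨G, hG⟩ := hz.exists_eval_mul (z β)
  rw [hG]
  refine hB.eval_eq_zero hβ (Sum.elim id id)
    (isWeightedHomogeneous_of_addChar _ G _ fun χ c => ?_)
    (by rintro (i | i) h; exacts [hu i h, hw i h])
  obtain ⟨v, hv⟩ := hz.exists_point (c ∘ Sum.inl)
  obtain ⟨v', hv'⟩ := hz.exists_point (c ∘ Sum.inr)
  obtain ⟨t, ht⟩ := exists_torusElement χ
  have h := hz.mem_gradedPart β χ t ht (v * v')
    (⟨t * v * t⁻¹, ht.conj_mem v.2⟩ * ⟨t * v' * t⁻¹, ht.conj_mem v'.2⟩) (by simp [mul_assoc])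
  rw [hG, hG] at h
  simp only [hz.apply_conj ht, hv, hv'] at h
  have h1 : c = Sum.elim (fun β => c (Sum.inl β)) fun β => c (Sum.inr β) :=
    (Sum.elim_comp_inl_inr c).symm
  rw [h1]
  refine Eq.trans ?_ h
  congr 2
  ext (i | i) <;> rfl

lemma apply_inv_eq_zero {B : Set (PosRoot b)} (hB : ClosedBySums B) {u : unipotentGroup b}
    (hu : ∀ β ∉ B, z β u = 0) : ∀ β ∉ B, z β u⁻¹ = 0 := by
  intro β hβ
  obtain ⟨S, hS⟩ := hz.exists_aeval_eq (antipodeHom (unipotentGroup b) (z β))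
  have hS' (v : unipotentGroup b) : z β v⁻¹ = MvPolynomial.eval (fun β => z β v) S := by
    rw [← antipodeHom_apply, ← hS, aeval_apply]
  rw [hS']
  refine hB.eval_eq_zero hβ id (hz.isWeightedHomogeneous ?_) hu
  rw [hS]
  intro χ t ht v v' hv
  rw [antipodeHom_apply, antipodeHom_apply]
  exact hz.mem_gradedPart β χ t ht v⁻¹ v'⁻¹ (by simp [hv, mul_assoc])

/-- `I(B)` is the ideal of functions vanishing at the points whose coordinates outside `B` are
zero. -/
lemma mem_rootIdeal_iff {B : Set (PosRoot b)} {f : ZDelta b} :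
    f ∈ rootIdeal z B ↔ ∀ u : unipotentGroup b, (∀ β ∉ B, z β u = 0) → f u = 0 := by
  classical
  refine ⟨fun hf u hu => ?_, fun hf => ?_⟩
  · have h : rootIdeal z B ≤ RingHom.ker (evalAt (unipotentGroup b) u) := by
      refine Ideal.span_le.2 ?_
      rintro _ ⟨β, hβ, rfl⟩
      exact hu β hβ
    exact h hf
  · obtain ⟨P, rfl⟩ := hz.exists_aeval_eq f
    have h1 : MvPolynomial.aeval (fun β => if β ∈ B then z β else 0) P = 0 := by
      refine coordRing_ext fun u => ?_
      obtain ⟨v, hv⟩ := hz.exists_point fun β => if β ∈ B then z β u else 0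
      have h2 := hf v fun β hβ => by rw [hv, if_neg hβ]
      rw [aeval_apply] at h2
      rw [evalAt_apply, aeval_apply, map_zero, ← h2]
      congr 2
      ext β
      rw [hv]
      split_ifs <;> rfl
    have h2 : (Ideal.Quotient.mkₐ k (rootIdeal z B)).comp (MvPolynomial.aeval z) =
        (Ideal.Quotient.mkₐ k (rootIdeal z B)).comp
          (MvPolynomial.aeval fun β => if β ∈ B then z β else 0) := by
      refine MvPolynomial.algHom_ext fun β => ?_
      simp only [AlgHom.comp_apply, MvPolynomial.aeval_X, Ideal.Quotient.mkₐ_eq_mk]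
      split_ifs with h
      · rfl
      · rw [map_zero, Ideal.Quotient.eq_zero_iff_mem]
        exact Ideal.subset_span ⟨β, h, rfl⟩
    have h3 := AlgHom.congr_fun h2 P
    rw [AlgHom.comp_apply, AlgHom.comp_apply, h1, map_zero] at h3
    exact Ideal.Quotient.eq_zero_iff_mem.1 h3

lemma coord_mem_rootIdeal_iff {B : Set (PosRoot b)} {β : PosRoot b} :
    z β ∈ rootIdeal z B ↔ β ∉ B := by
  classical
  refine ⟨fun h hβ => ?_, fun h => Ideal.subset_span ⟨β, h, rfl⟩⟩
  obtain ⟨u, hu⟩ := hz.exists_point (Pi.single β 1)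
  have h1 := hz.mem_rootIdeal_iff.1 h u fun γ hγ => by
    rw [hu, Pi.single_eq_of_ne]
    rintro rfl
    exact hγ hβ
  rw [hu, Pi.single_eq_same] at h1
  exact one_ne_zero h1

lemma rootIdeal_le_iff {B B' : Set (PosRoot b)} :
    rootIdeal z B ≤ rootIdeal z B' ↔ B' ⊆ B := by
  refine ⟨fun h β hβ => ?_, fun h =>
    Ideal.span_mono (Set.image_mono (Set.compl_subset_compl.2 h))⟩
  by_contra hβ'
  exact hz.coord_mem_rootIdeal_iff.1 (h (hz.coord_mem_rootIdeal_iff.2 hβ')) hβ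

/-- The subset of the unipotent group defined by `I(B)` is a subgroup, so `I(B)` is a Hopf
ideal. -/
lemma isHopfIdeal_rootIdeal {B : Set (PosRoot b)} (hB : ClosedBySums B) :
    (rootIdeal z B).IsHopfIdeal k where
  counit_eq_zero f hf := hz.mem_rootIdeal_iff.1 hf 1 fun β _ => hz.apply_one β
  map_mkQ_comul_eq_zero f hf := by
    let S := {u : unipotentGroup b // ∀ β ∉ B, z β u = 0}
    let I := (rootIdeal z B).restrictScalars k
    let φ (u : S) : (ZDelta b ⧸ I) →ₗ[k] k := I.liftQ (evalAt (unipotentGroup b) u).toLinearMap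
      fun f hf => hz.mem_rootIdeal_iff.1 hf u u.2
    have hφ : ∀ a, (∀ u, φ u a = 0) → a = 0 := by
      intro a ha
      obtain ⟨f, rfl⟩ := I.mkQ_surjective a
      refine (Submodule.Quotient.mk_eq_zero I).2 (hz.mem_rootIdeal_iff.2 fun u hu => ha ⟨u, hu⟩)
    refine tensor_separate φ φ hφ hφ _ fun u w => ?_
    rw [← LinearMap.comp_apply (TensorProduct.map _ _), ← TensorProduct.map_comp]
    exact (lid_map_evalAt_comulHom (unipotentGroup b) u.1 w.1 f).trans
      (hz.mem_rootIdeal_iff.1 hf _ (hz.apply_mul_eq_zero hB u.2 w.2))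
  antipode_mem f hf := hz.mem_rootIdeal_iff.2 fun u hu =>
    hz.mem_rootIdeal_iff.1 hf u⁻¹ (hz.apply_inv_eq_zero hB hu)

open Classical in
lemma isHomogeneous_rootIdeal (B : Set (PosRoot b)) :
    (rootIdeal z B).IsHomogeneous (gradedPart b) := by
  refine Ideal.homogeneous_span _ _ ?_
  rintro _ ⟨β, -, rfl⟩
  exact ⟨β.deg, hz.mem_gradedPart β⟩

end IsRootCoordinates

end Points

/-! ### Brackets of root spaces -/

section Bracket

variable {k g : Type*} [Field k] [CharZero k] [LieRing g] [LieAlgebra k g] [IsKilling k g]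
  [FiniteDimensional k g] {H : LieSubalgebra k g} [H.IsCartanSubalgebra]
  [IsTriangularizable k H g]

/-- If `α + β` is a weight, then nonzero root vectors for `α` and `β` have a nonzero bracket: up to
a scalar, the root vector for `β` is `f ^ q v`, where `(h, e, f)` is an `sl₂`-triple for `α` and `v`
spans the top of the `α`-chain through `β`, and `⁅e, f ^ q v⁆` is a nonzero multiple of
`f ^ (q - 1) v`. -/
lemma lie_ne_zero_of_add {α β : Weight k H g} (hα : α.IsNonZero) (hβ : β.IsNonZero)
    (hαβ : rootSpace H (α + β : H → k) ≠ ⊥) {x y : g} (hx : x ∈ rootSpace H α) (hx0 : x ≠ 0)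
    (hy : y ∈ rootSpace H β) (hy0 : y ≠ 0) : ⁅x, y⁆ ≠ 0 := by
  obtain ⟨v, hv, hv0⟩ := (chainTop α β).exists_ne_zero
  obtain ⟨h, e, f, isSl2, he, hf⟩ := exists_isSl2Triple_of_weight_isNonZero hα
  obtain rfl := isSl2.h_eq_coroot hα he hf
  have prim : isSl2.HasPrimitiveVectorWith v (chainLength α β : k) :=
    have := lie_mem_genWeightSpace_of_mem_genWeightSpace he hv
    ⟨hv0, (chainLength_smul _ _ hv).symm, by rwa [genWeightSpace_add_chainTop _ _ hα] at this⟩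
  obtain ⟨q, hq⟩ : ∃ q, chainTopCoeff α β = q + 1 := by
    refine Nat.exists_eq_succ_of_ne_zero fun h0 => hαβ ?_
    have := genWeightSpace_chainTopCoeff_add_one_nsmul_add (M := g) α β hα
    rwa [h0, zero_add, one_smul] at this
  have hle : q + 1 ≤ chainLength α β := hq ▸ chainTopCoeff_le_chainLength α β
  have hw : (toEnd k g g f ^ (q + 1)) v ∈ rootSpace H β := by
    have := toEnd_pow_apply_mem hf hv (q + 1)
    rwa [coe_chainTop', hq, smul_neg, neg_add_cancel_left] at this
  have hw0 : (toEnd k g g f ^ (q + 1)) v ≠ 0 := prim.pow_toEnd_f_ne_zero_of_eq_nat rfl hle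
  obtain ⟨c, hc⟩ : ∃ c : k, c • (toEnd k g g f ^ (q + 1)) v = y := by
    simpa using (finrank_eq_one_iff_of_nonzero' ⟨_, hw⟩ (by simpa using hw0)).mp
      (finrank_rootSpace_eq_one _ hβ) ⟨y, hy⟩
  obtain ⟨d, hd⟩ : ∃ d : k, d • e = x := by
    simpa using (finrank_eq_one_iff_of_nonzero' ⟨e, he⟩ (by simpa using isSl2.e_ne_zero)).mp
      (finrank_rootSpace_eq_one _ hα) ⟨x, hx⟩
  have hc0 : c ≠ 0 := by rintro rfl; exact hy0 (by rw [← hc, zero_smul])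
  have hd0 : d ≠ 0 := by rintro rfl; exact hx0 (by rw [← hd, zero_smul])
  rw [← hc, ← hd, smul_lie, lie_smul, prim.lie_e_pow_succ_toEnd_f]
  refine smul_ne_zero hd0 (smul_ne_zero hc0 (smul_ne_zero (mul_ne_zero ?_ ?_)
    (prim.pow_toEnd_f_ne_zero_of_eq_nat rfl (by omega))))
  · exact Nat.cast_add_one_ne_zero q
  · rw [sub_ne_zero, Ne, Nat.cast_inj]
    omega

end Bracket

section Tangent

variable {k g : Type*} [Field k] [CharZero k] [LieRing g] [LieAlgebra k g] [IsKilling k g]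
  [FiniteDimensional k g] {H : LieSubalgebra k g} [H.IsCartanSubalgebra]
  [IsTriangularizable k H g] {b : (rootSystem H).Base}

/-! ### Tangent functionals -/

omit [IsKilling k g] [FiniteDimensional k g] in
/-- The matrix entry of `exp (ad (s x))` as a polynomial in `s`. -/
lemma expAd_smul_apply {x : g} {M : ℕ} (hM : (ad k g x) ^ M = 0) (φ : Module.Dual k g) (v : g)
    (s : k) : φ (expAd (k := k) (s • x) v) = (∑ i ∈ Finset.range M,
      Polynomial.monomial i ((i.factorial : k)⁻¹ * φ ((ad k g x ^ i) v))).eval s := by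
  rw [expAd_eq_sum (n := M) (by rw [map_smul, smul_pow, hM, smul_zero])]
  simp only [map_smul, smul_pow, LinearMap.sum_apply, LinearMap.smul_apply, map_sum,
    Polynomial.eval_finsetSum, Polynomial.eval_monomial, smul_eq_mul]
  exact Finset.sum_congr rfl fun i _ => by ring

/-- A regular function restricted to a one-parameter subgroup is polynomial in the parameter. -/
lemma exists_curveHom {x : g} (hx : x ∈ nPlus b) : ∃ Φ : ZDelta b →ₐ[k] Polynomial k,
    ∀ f s, (Φ f).eval s = f (expPos (s • x) (Submodule.smul_mem _ s hx)) := by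
  let E : Polynomial k →ₐ[k] (k → k) := AlgHom.pi fun s => Polynomial.aeval s
  have hE' (p : Polynomial k) (s : k) : E p s = p.eval s :=
    congrFun (Polynomial.coe_aeval_eq_eval s) p
  have hE : Function.Injective E := fun p q h => Polynomial.funext fun s => by
    rw [← hE', ← hE', h]
  let L : ZDelta b →ₐ[k] (k → k) :=
    AlgHom.pi fun s => evalAt (unipotentGroup b) (expPos (s • x) (Submodule.smul_mem _ s hx))
  have hL (f : ZDelta b) : L f ∈ E.range := by
    obtain ⟨M, hM⟩ := exists_ad_pow_eq_zero b
    induction f using coordRing_induction with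
    | _entry φ v =>
      refine ⟨_, funext fun s => (hE' _ s).trans ((expAd_smul_apply (hM x hx) φ v s).symm.trans ?_)⟩
      rw [← expPos_apply (Submodule.smul_mem _ s hx)]
      rfl
    | _entry_inv φ v =>
      refine ⟨_, funext fun s => (hE' _ s).trans
        ((expAd_smul_apply (hM (-x) (neg_mem hx)) φ v s).symm.trans ?_)⟩
      rw [smul_neg, ← expPos_inv_apply (Submodule.smul_mem _ s hx)]
      rfl
    | _const c => rw [AlgHom.commutes]; exact Subalgebra.algebraMap_mem _ c
    | _add f f' h h' => rw [map_add]; exact add_mem h h'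
    | _mul f f' h h' => rw [map_mul]; exact mul_mem h h'
  refine ⟨(AlgEquiv.ofInjective E hE).symm.toAlgHom.comp (L.codRestrict E.range hL), fun f s => ?_⟩
  have h := congrArg Subtype.val ((AlgEquiv.ofInjective E hE).apply_symm_apply
    (L.codRestrict E.range hL f))
  exact (hE' _ s).symm.trans (congrFun h s)

/-- The restriction of regular functions to the one-parameter subgroup `s ↦ exp (ad (s x))`. -/
noncomputable def curveHom (x : g) (hx : x ∈ nPlus b) : ZDelta b →ₐ[k] Polynomial k :=
  (exists_curveHom hx).choose

lemma eval_curveHom {x : g} (hx : x ∈ nPlus b) (f : ZDelta b) (s : k) :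
    (curveHom x hx f).eval s = f (expPos (s • x) (Submodule.smul_mem _ s hx)) :=
  (exists_curveHom hx).choose_spec f s

/-- The tangent vector to the unipotent group at `1` given by `x ∈ n₊`, as a functional on regular
functions: the derivative at `s = 0` along `s ↦ exp (ad (s x))`. -/
noncomputable def tangent (x : g) (hx : x ∈ nPlus b) : ZDelta b →ₗ[k] k :=
  Polynomial.lcoeff k 1 ∘ₗ (curveHom x hx).toLinearMap

lemma tangent_apply {x : g} (hx : x ∈ nPlus b) (f : ZDelta b) :
    tangent x hx f = (curveHom x hx f).coeff 1 := rfl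

lemma expPos_zero : expPos (0 : g) (zero_mem (nPlus b)) = 1 := by
  refine Subtype.ext (LinearEquiv.toLinearMap_injective ?_)
  rw [coe_expPos, expAd_eq_sum (n := 1) (by simp)]
  simp only [Finset.range_one, Finset.sum_singleton, pow_zero, Nat.factorial_zero, Nat.cast_one,
    inv_one, one_smul]
  rfl

lemma coeff_zero_curveHom {x : g} (hx : x ∈ nPlus b) (f : ZDelta b) :
    (curveHom x hx f).coeff 0 = f 1 := by
  rw [Polynomial.coeff_zero_eq_eval_zero, eval_curveHom]
  congr 1
  simp only [zero_smul]
  exact expPos_zero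

lemma tangent_mul {x : g} (hx : x ∈ nPlus b) (f f' : ZDelta b) :
    tangent x hx (f * f') = f 1 * tangent x hx f' + tangent x hx f * f' 1 := by
  rw [tangent_apply, map_mul, Polynomial.mul_coeff_one, coeff_zero_curveHom, coeff_zero_curveHom]
  rfl

lemma tangent_entry {x : g} (hx : x ∈ nPlus b) (φ : Module.Dual k g) (v : g) :
    tangent x hx (entry _ φ v) = φ ⁅x, v⁆ := by
  obtain ⟨M, hM⟩ := exists_ad_pow_eq_zero b
  have h : curveHom x hx (entry _ φ v) = ∑ i ∈ Finset.range (M + 2),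
      Polynomial.monomial i ((i.factorial : k)⁻¹ * φ ((ad k g x ^ i) v)) := by
    refine Polynomial.funext fun s => ?_
    rw [← expAd_smul_apply (by rw [pow_add, hM x hx, zero_mul]), eval_curveHom,
      ← expPos_apply (Submodule.smul_mem _ s hx)]
    rfl
  rw [tangent_apply, h, Polynomial.finsetSum_coeff, Finset.sum_eq_single 1]
  · simp
  · intro i _ hi
    rw [Polynomial.coeff_monomial, if_neg hi]
  · simp

lemma tangent_entryInv {x : g} (hx : x ∈ nPlus b) (φ : Module.Dual k g) (v : g) :
    tangent x hx (entryInv _ φ v) = -φ ⁅x, v⁆ := by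
  have h : curveHom x hx (entryInv _ φ v) = curveHom (-x) (neg_mem hx) (entry _ φ v) := by
    refine Polynomial.funext fun s => ?_
    rw [eval_curveHom, eval_curveHom, entry_apply, entryInv_apply, expPos_inv_apply, expPos_apply,
      smul_neg]
  rw [tangent_apply, h, ← tangent_apply, tangent_entry, neg_lie, map_neg]

omit [CharZero k] [IsKilling k g] [FiniteDimensional k g] in
/-- A functional satisfying the Leibniz rule at `1` is determined by its values on the matrix
entries of `u` and `u⁻¹`. -/
lemma eq_of_leibniz {N : Subgroup (g ≃ₗ[k] g)} {δ δ' : CoordRing N →ₗ[k] k}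
    (h : ∀ f f', δ (f * f') = f 1 * δ f' + δ f * f' 1)
    (h' : ∀ f f', δ' (f * f') = f 1 * δ' f' + δ' f * f' 1)
    (he : ∀ φ v, δ (entry N φ v) = δ' (entry N φ v))
    (hi : ∀ φ v, δ (entryInv N φ v) = δ' (entryInv N φ v)) : δ = δ' := by
  have h1 {δ : CoordRing N →ₗ[k] k} (h : ∀ f f', δ (f * f') = f 1 * δ f' + δ f * f' 1) :
      δ 1 = 0 := by
    have := h 1 1
    rw [mul_one, one_apply] at this
    linear_combination -this
  refine LinearMap.ext fun f => ?_
  induction f using coordRing_induction with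
  | _entry φ v => exact he φ v
  | _entry_inv φ v => exact hi φ v
  | _const c => rw [Algebra.algebraMap_eq_smul_one, map_smul, map_smul, h1 h, h1 h']
  | _add f f' h h' => rw [map_add, map_add, h, h']
  | _mul f f' e e' => rw [h, h', e, e']

lemma tangent_smul {x : g} (hx : x ∈ nPlus b) {y : g} (hy : y ∈ nPlus b) {c : k} (h : y = c • x)
    (f : ZDelta b) : tangent y hy f = c * tangent x hx f := by
  subst h
  suffices h : tangent (c • x) hy = c • tangent x hx from LinearMap.congr_fun h f
  refine eq_of_leibniz (tangent_mul hy) (fun f f' => ?_) (fun φ v => ?_) (fun φ v => ?_)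
  · simp only [LinearMap.smul_apply, tangent_mul, smul_eq_mul]
    ring
  · simp only [LinearMap.smul_apply, tangent_entry, smul_lie, map_smul]
  · simp only [LinearMap.smul_apply, tangent_entryInv, smul_lie, map_smul, smul_neg]

/-- Conjugation by a torus element rescales the one-parameter subgroup of a root vector. -/
lemma conj_expPos {χ : AddChar (RootLattice H) k} {t : g ≃ₗ[k] g} (ht : IsTorusElement χ t)
    {γ : PosRoot b} {x : g} (hx : x ∈ nPlus b) (hxγ : x ∈ rootSpace H (γ.1 : Weight k H g)) (s : k) :
    (⟨t * expPos (s • x) (Submodule.smul_mem _ s hx) * t⁻¹, ht.conj_mem (Subtype.mem _)⟩ :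
      unipotentGroup b) = expPos ((χ γ.deg * s) • x) (Submodule.smul_mem _ _ hx) := by
  obtain ⟨M, hM⟩ := exists_ad_pow_eq_zero b
  refine Subtype.ext (LinearEquiv.ext fun y => ?_)
  rw [expPos_apply, LinearEquiv.mul_apply, LinearEquiv.mul_apply, expPos_apply]
  have htx : t (s • x) = (χ γ.deg * s) • x := by
    rw [map_smul, ht _ x hxγ, weightDeg_posRoot, smul_smul, mul_comm]
  have hpow (i : ℕ) : t ((ad k g (s • x) ^ i) (t⁻¹ y)) = (ad k g (t (s • x)) ^ i) y := by
    induction i with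
    | zero => exact t.apply_symm_apply y
    | succ i ih =>
      rw [pow_succ', Module.End.mul_apply, ad_apply, ht.map_lie, ih, pow_succ',
        Module.End.mul_apply, ad_apply]
  rw [← htx, expAd_eq_sum (hM _ (Submodule.smul_mem _ s hx)),
    expAd_eq_sum (hM _ (ht.mem_nPlus (Submodule.smul_mem _ s hx)))]
  simp only [LinearMap.sum_apply, LinearMap.smul_apply, map_sum]
  exact Finset.sum_congr rfl fun i _ => (map_smul t _ _).trans (congrArg _ (hpow i))

lemma tangent_of_conj {χ : AddChar (RootLattice H) k} {t : g ≃ₗ[k] g} (ht : IsTorusElement χ t)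
    {γ : PosRoot b} {x : g} (hx : x ∈ nPlus b) (hxγ : x ∈ rootSpace H (γ.1 : Weight k H g))
    {f f' : ZDelta b} {a : k}
    (hf : ∀ u : unipotentGroup b, f' ⟨t * u * t⁻¹, ht.conj_mem u.2⟩ = a * f u) :
    χ γ.deg * tangent x hx f' = a * tangent x hx f := by
  have h : (curveHom x hx f').comp (Polynomial.C (χ γ.deg) * Polynomial.X) =
      Polynomial.C a * curveHom x hx f := by
    refine Polynomial.funext fun s => ?_
    rw [Polynomial.eval_comp, Polynomial.eval_mul, Polynomial.eval_mul, Polynomial.eval_C,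
      Polynomial.eval_C, Polynomial.eval_X, eval_curveHom, eval_curveHom, ← hf,
      conj_expPos ht hx hxγ]
  have h1 := congrArg (fun p => Polynomial.coeff p 1) h
  simp only [Polynomial.comp_C_mul_X_coeff, pow_one, Polynomial.coeff_C_mul] at h1
  rw [tangent_apply, tangent_apply, ← h1, mul_comm]

/-- The tangent vector of a root vector for `γ` sees only the functions of degree `γ`. -/
lemma tangent_eq_zero_of_mem_gradedPart {γ : PosRoot b} {x : g} (hx : x ∈ nPlus b)
    (hxγ : x ∈ rootSpace H (γ.1 : Weight k H g)) {ν : RootLattice H} (hν : ν ≠ γ.deg)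
    {f : ZDelta b} (hf : f ∈ gradedPart b ν) : tangent x hx f = 0 := by
  by_contra h0
  refine hν (evalChar_injective (k := k) (MonoidHom.ext fun χ => ?_))
  obtain ⟨t, ht⟩ := exists_torusElement χ
  exact mul_right_cancel₀ h0 (tangent_of_conj ht hx hxγ fun u => hf χ t ht u _ rfl).symm

lemma IsRootCoordinates.tangent_coord_ne_zero {z : PosRoot b → ZDelta b}
    (hz : IsRootCoordinates b z) {γ : PosRoot b} {x : g} (hx : x ∈ nPlus b)
    (hxγ : x ∈ rootSpace H (γ.1 : Weight k H g)) (hx0 : x ≠ 0) : tangent x hx (z γ) ≠ 0 := by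
  intro h0
  have hβ (β : PosRoot b) : tangent x hx (z β) = 0 := by
    by_cases h : β = γ
    · rw [h, h0]
    · exact tangent_eq_zero_of_mem_gradedPart hx hxγ (fun h' => h (deg_injective h'))
        (hz.mem_gradedPart β)
  have h1 : tangent x hx (1 : ZDelta b) = 0 := by
    rw [tangent_apply, map_one, Polynomial.coeff_one]
    simp
  have hf (f : ZDelta b) : tangent x hx f = 0 := by
    have hmem : f ∈ Algebra.adjoin k (Set.range z) := hz.adjoin_eq_top ▸ Algebra.mem_top
    induction hmem using Algebra.adjoin_induction with
    | mem f hf =>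
      obtain ⟨β, rfl⟩ := hf
      exact hβ β
    | algebraMap c => rw [Algebra.algebraMap_eq_smul_one, map_smul, h1, smul_zero]
    | add f f' _ _ h h' => rw [map_add, h, h', add_zero]
    | mul f f' _ _ h h' => rw [tangent_mul, h, h', mul_zero, zero_mul, add_zero]
  obtain ⟨h, hh⟩ := exists_regular (k := k) (g := g) H
  have h2 : ⁅(h : g), x⁆ = (γ.1 : Weight k H g) h • x := lie_eq_smul_of_mem_rootSpace hxγ h
  have h3 : ⁅x, (h : g)⁆ = 0 := (Module.forall_dual_apply_eq_zero_iff k _).1 fun φ => by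
    rw [← tangent_entry hx, hf]
  rw [← lie_skew, h3, neg_zero, eq_comm, smul_eq_zero] at h2
  exact h2.elim (posRoot_apply_ne_zero hh γ) hx0

/-! ### Invariant derivations -/

/-- Left translation of regular functions: `(leftTranslate u f) w = f (u w)`. -/
def leftTranslate (u : unipotentGroup b) : ZDelta b →ₐ[k] ZDelta b :=
  (AlgHom.pi fun w : unipotentGroup b => evalAt (unipotentGroup b) (u * w)).codRestrict
    (coordSubalgebra (unipotentGroup b)) fun f => by
    induction f using coordRing_induction with
    | _entry φ v => exact (entry (unipotentGroup b) (φ ∘ₗ (u : g ≃ₗ[k] g).toLinearMap) v).2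
    | _entry_inv φ v =>
      convert! (entryInv (unipotentGroup b) φ (((u⁻¹ : unipotentGroup b) : g ≃ₗ[k] g) v)).2 using 1
    | _const c => rw [AlgHom.commutes]; exact Subalgebra.algebraMap_mem _ c
    | _add f f' h h' => rw [map_add]; exact add_mem h h'
    | _mul f f' h h' => rw [map_mul]; exact mul_mem h h'

@[simp] lemma leftTranslate_apply (u w : unipotentGroup b) (f : ZDelta b) :
    leftTranslate u f w = f (u * w) := rfl

lemma lid_map_evalAt_comulHom_eq (u : unipotentGroup b) (f : ZDelta b) :
    TensorProduct.lid k _ (TensorProduct.map (evalAt (unipotentGroup b) u).toLinearMap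
      LinearMap.id (comulHom (unipotentGroup b) f)) = leftTranslate u f := by
  refine coordRing_ext fun w => ?_
  rw [evalAt_apply, evalAt_apply, leftTranslate_apply, ← lid_map_evalAt_comulHom]
  induction comulHom (unipotentGroup b) f with
  | zero => simp
  | add x y hx hy => rw [map_add, map_add, add_apply, hx, hy, map_add, map_add]
  | tmul x y => simp

/-- The left invariant derivation of `Z_Δ` given by `x ∈ n₊`: `(id ⊗ ∂ₓ) ∘ Δ`. -/
noncomputable def invDeriv (x : g) (hx : x ∈ nPlus b) : ZDelta b →ₗ[k] ZDelta b :=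
  (TensorProduct.rid k _).toLinearMap ∘ₗ TensorProduct.map LinearMap.id (tangent x hx) ∘ₗ
    (comulHom (unipotentGroup b)).toLinearMap

lemma invDeriv_apply {x : g} (hx : x ∈ nPlus b) (f : ZDelta b) (u : unipotentGroup b) :
    invDeriv x hx f u = tangent x hx (leftTranslate u f) := by
  rw [← lid_map_evalAt_comulHom_eq]
  change (TensorProduct.rid k _ (TensorProduct.map LinearMap.id (tangent x hx)
    (comulHom (unipotentGroup b) f)) : ZDelta b) u = _
  induction comulHom (unipotentGroup b) f with
  | zero => simp
  | add x y hx hy => rw [map_add, map_add, add_apply, hx, hy, map_add, map_add, map_add]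
  | tmul x y => simp [mul_comm]

lemma invDeriv_mul {x : g} (hx : x ∈ nPlus b) (f f' : ZDelta b) :
    invDeriv x hx (f * f') = f * invDeriv x hx f' + f' * invDeriv x hx f := by
  refine coordRing_ext fun u => ?_
  simp only [evalAt_apply, add_apply, mul_apply, invDeriv_apply, map_mul, tangent_mul,
    leftTranslate_apply, mul_one]
  ring

lemma invDeriv_apply_one {x : g} (hx : x ∈ nPlus b) (f : ZDelta b) :
    invDeriv x hx f 1 = tangent x hx f := by
  have h : leftTranslate 1 f = f := coordRing_ext fun w => by simp
  rw [invDeriv_apply, h]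

lemma invDeriv_entry {x : g} (hx : x ∈ nPlus b) (φ : Module.Dual k g) (v : g) :
    invDeriv x hx (entry _ φ v) = entry _ φ ⁅x, v⁆ := by
  refine coordRing_ext fun u => ?_
  have h : leftTranslate u (entry (unipotentGroup b) φ v) =
    entry (unipotentGroup b) (φ ∘ₗ (u : g ≃ₗ[k] g).toLinearMap) v := rfl
  rw [evalAt_apply, invDeriv_apply, h, tangent_entry]
  rfl

lemma invDeriv_entryInv {x : g} (hx : x ∈ nPlus b) (φ : Module.Dual k g) (v : g) :
    invDeriv x hx (entryInv _ φ v) = entryInv _ (-(φ ∘ₗ ad k g x)) v := by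
  refine coordRing_ext fun u => ?_
  have h : leftTranslate u (entryInv (unipotentGroup b) φ v) =
      entryInv (unipotentGroup b) φ (((u⁻¹ : unipotentGroup b) : g ≃ₗ[k] g) v) :=
    coordRing_ext fun w => by simp
  rw [evalAt_apply, invDeriv_apply, h, tangent_entryInv]
  simp

/-- The commutator of two tangent vectors, for the convolution product of functionals on `Z_Δ`, is
the tangent vector of the bracket. -/
lemma tangent_lie {x y : g} (hx : x ∈ nPlus b) (hy : y ∈ nPlus b) (hxy : ⁅x, y⁆ ∈ nPlus b)
    (f : ZDelta b) : tangent ⁅x, y⁆ hxy f =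
      tangent x hx (invDeriv y hy f) - tangent y hy (invDeriv x hx f) := by
  suffices h : tangent ⁅x, y⁆ hxy =
      tangent x hx ∘ₗ invDeriv y hy - tangent y hy ∘ₗ invDeriv x hx from LinearMap.congr_fun h f
  refine eq_of_leibniz (tangent_mul hxy) (fun f f' => ?_) (fun φ v => ?_) (fun φ v => ?_)
  · simp only [LinearMap.sub_apply, LinearMap.comp_apply, invDeriv_mul, map_add, tangent_mul,
      invDeriv_apply_one]
    ring
  · simp only [LinearMap.sub_apply, LinearMap.comp_apply, invDeriv_entry, tangent_entry, lie_lie,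
      map_sub]
  · simp only [LinearMap.sub_apply, LinearMap.comp_apply, invDeriv_entryInv, tangent_entryInv,
      lie_lie, map_sub, LinearMap.neg_apply, ad_apply]
    ring

/-- The invariant derivation of a root vector for `γ` lowers degrees by `γ`. -/
lemma invDeriv_mem_gradedPart {γ : PosRoot b} {x : g} (hx : x ∈ nPlus b)
    (hxγ : x ∈ rootSpace H (γ.1 : Weight k H g)) {ν : RootLattice H} {f : ZDelta b}
    (hf : f ∈ gradedPart b ν) : invDeriv x hx f ∈ gradedPart b (ν - γ.deg) := by
  intro χ t ht u u' hu
  rw [invDeriv_apply, invDeriv_apply]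
  have h := tangent_of_conj (f := leftTranslate u f) (f' := leftTranslate u' f) (a := χ ν) ht hx
    hxγ fun w => by
      rw [leftTranslate_apply, leftTranslate_apply]
      exact hf χ t ht (u * w) _ (by simp [hu, mul_assoc])
  have h1 : χ ν = χ (ν - γ.deg) * χ γ.deg := by
    rw [← AddChar.map_add_eq_mul, sub_add_cancel]
  have h2 : χ (-γ.deg) * χ γ.deg = 1 := by
    rw [← AddChar.map_add_eq_mul, neg_add_cancel, AddChar.map_zero_eq_one]
  refine mul_left_cancel₀ (right_ne_zero_of_mul_eq_one h2) (h.trans ?_)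
  rw [h1]
  ring

/-- A Hopf ideal killed by a tangent vector is stable under its invariant derivation. -/
lemma invDeriv_mem {J : Ideal (ZDelta b)} (hJ : J.IsHopfIdeal k) {x : g} (hx : x ∈ nPlus b)
    (hxJ : ∀ f ∈ J, tangent x hx f = 0) {f : ZDelta b} (hf : f ∈ J) : invDeriv x hx f ∈ J := by
  let I := J.restrictScalars k
  let δ : (ZDelta b ⧸ I) →ₗ[k] k := I.liftQ (tangent x hx) hxJ
  have h1 : TensorProduct.map I.mkQ I.mkQ (comulHom (unipotentGroup b) f) = 0 :=
    hJ.map_mkQ_comul_eq_zero hf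
  have h2 (t : ZDelta b ⊗[k] ZDelta b) :
      I.mkQ (TensorProduct.rid k _ (TensorProduct.map LinearMap.id (tangent x hx) t)) =
        TensorProduct.rid k _ (TensorProduct.map LinearMap.id δ
          (TensorProduct.map I.mkQ I.mkQ t)) := by
    induction t with
    | zero => simp
    | add x y hx hy => simp only [map_add, hx, hy]
    | tmul x y =>
      simp only [TensorProduct.map_tmul, TensorProduct.rid_tmul, map_smul, LinearMap.id_apply]
      rfl
  have h3 := h2 (comulHom (unipotentGroup b) f)
  rw [h1, map_zero, map_zero] at h3
  exact (Submodule.Quotient.mk_eq_zero I).1 h3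

end Tangent

section HopfIdeals

variable {k g : Type*} [Field k] [CharZero k] [LieRing g] [LieAlgebra k g] [IsKilling k g]
  [FiniteDimensional k g] {H : LieSubalgebra k g} [H.IsCartanSubalgebra]
  [IsTriangularizable k H g] {b : (rootSystem H).Base}

/-! ### Graded Hopf ideals and their closed sets of roots -/

/-- The positive roots whose root vectors, as tangent vectors at `1`, kill the ideal `J`. -/
def tangentRoots (J : Ideal (ZDelta b)) : Set (PosRoot b) :=
  {γ | ∀ f ∈ J, tangent (rootVec γ) (rootVec_mem_nPlus γ) f = 0}

lemma closedBySums_tangentRoots {J : Ideal (ZDelta b)} (hJ : J.IsHopfIdeal k) :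
    ClosedBySums (tangentRoots J) := by
  intro α hα β hβ γ hγ f hf
  have hcoe : ((γ.1 : Weight k H g) : H → k) = (α.1 : Weight k H g) + (β.1 : Weight k H g) := by
    have h1 := congrArg Subtype.val hγ
    funext x
    exact LinearMap.congr_fun h1 x
  have hmem : ⁅rootVec α, rootVec β⁆ ∈ rootSpace H (γ.1 : Weight k H g) := by
    rw [hcoe]
    exact lie_mem_genWeightSpace_of_mem_genWeightSpace (rootVec_mem α) (rootVec_mem β)
  have hne : ⁅rootVec α, rootVec β⁆ ≠ 0 :=
    lie_ne_zero_of_add (LieSubalgebra.isNonZero_coe_root α.1) (LieSubalgebra.isNonZero_coe_root β.1)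
      (hcoe ▸ (γ.1 : Weight k H g).genWeightSpace_ne_bot) (rootVec_mem α) (rootVec_ne_zero α)
      (rootVec_mem β) (rootVec_ne_zero β)
  have hn : ⁅rootVec α, rootVec β⁆ ∈ nPlus b := Submodule.mem_iSup_of_mem γ hmem
  have hc : ⁅rootVec α, rootVec β⁆ = rootCoord γ ⁅rootVec α, rootVec β⁆ • rootVec γ := by
    rw [← weightProj_eq_rootCoord_smul, weightProj_same hmem]
  have h1 := tangent_lie (rootVec_mem_nPlus α) (rootVec_mem_nPlus β) hn f
  rw [hα _ (invDeriv_mem hJ _ hβ hf), hβ _ (invDeriv_mem hJ _ hα hf), sub_zero,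
    tangent_smul (rootVec_mem_nPlus γ) hn hc] at h1
  refine (mul_eq_zero.1 h1).resolve_left fun h0 => hne ?_
  rw [hc, h0, zero_smul]

lemma ht_weight_pos {d : PosRoot b →₀ ℕ} (hd : d ≠ 0) :
    0 < ht b (Finsupp.weight PosRoot.deg d) := by
  rw [Finsupp.weight_apply, Finsupp.sum, map_sum]
  refine Finset.sum_pos (fun i hi => ?_) (Finsupp.support_nonempty_iff.2 hd)
  rw [map_nsmul]
  exact nsmul_pos (ht_deg_pos i) (Finsupp.mem_support_iff.1 hi)

open Classical in
/-- A homogeneous ideal is determined by its homogeneous elements. -/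
lemma exists_mem_gradedPart_of_ne_zero {J : Ideal (ZDelta b)}
    (hJ : J.IsHomogeneous (gradedPart b)) {M : Type*} [AddCommGroup M] [Module k M]
    (δ : ZDelta b →ₗ[k] M) {f : ZDelta b} (hf : f ∈ J) (h : δ f ≠ 0) :
    ∃ ν, ∃ f' ∈ J, f' ∈ gradedPart b ν ∧ δ f' ≠ 0 := by
  by_contra! hcon
  refine h ?_
  rw [← DirectSum.sum_support_decompose (gradedPart b) f, map_sum]
  exact Finset.sum_eq_zero fun ν _ => hcon ν _ (hJ ν hf) (SetLike.coe_mem _)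

lemma invDeriv_aeval {ι : Type*} [Fintype ι] (y : ι → ZDelta b) {x : g} (hx : x ∈ nPlus b)
    (P : MvPolynomial ι k) : invDeriv x hx (MvPolynomial.aeval y P) =
      ∑ i, MvPolynomial.aeval y (MvPolynomial.pderiv i P) * invDeriv x hx (y i) := by
  classical
  have h1 : invDeriv x hx (1 : ZDelta b) = 0 := by
    have := invDeriv_mul hx 1 1
    rwa [mul_one, one_mul, left_eq_add] at this
  induction P using MvPolynomial.induction_on with
  | C a =>
    simp [Algebra.algebraMap_eq_smul_one, h1]
  | add p q hp hq => simp only [map_add, hp, hq, add_mul, Finset.sum_add_distrib]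
  | mul_X p j hp =>
    rw [map_mul, invDeriv_mul, hp, MvPolynomial.aeval_X, Finset.mul_sum]
    simp only [Derivation.leibniz, MvPolynomial.pderiv_X, smul_eq_mul, map_add, map_mul,
      MvPolynomial.aeval_X, add_mul, Finset.sum_add_distrib]
    congr 1
    · rw [Finset.sum_eq_single j (fun i _ hi => by simp [hi.symm]) (by simp)]
      simp
    · exact Finset.sum_congr rfl fun i _ => by ring

namespace IsRootCoordinates

variable {z : PosRoot b → ZDelta b} (hz : IsRootCoordinates b z)
include hz

lemma eq_algebraMap_of_ht_nonpos {ν : RootLattice H} (hν : ht b ν ≤ 0) {f : ZDelta b}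
    (hf : f ∈ gradedPart b ν) : f = algebraMap k _ (f 1) ∧ (ν ≠ 0 → f = 0) := by
  obtain ⟨P, rfl⟩ := hz.exists_aeval_eq f
  have hP := hz.isWeightedHomogeneous hf
  have hcoeff (d : PosRoot b →₀ ℕ) (hd : d ≠ 0) : P.coeff d = 0 := by
    by_contra h
    have := ht_weight_pos hd
    rw [hP h] at this
    omega
  have hC : P = MvPolynomial.C (P.coeff 0) := by
    classical
    ext d
    rw [MvPolynomial.coeff_C]
    split_ifs with h
    · rw [h]
    · exact hcoeff d (Ne.symm h)
  refine ⟨?_, fun hν0 => ?_⟩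
  · rw [aeval_apply, hC, MvPolynomial.aeval_C, MvPolynomial.eval_C]
  · rw [hC, hP.coeff_eq_zero 0 (by rw [map_zero]; exact hν0.symm), map_zero, map_zero]

/-- The coordinates of degree outside the set of tangent roots of `J` lie in `J`: some element of
`J` of degree `β` is a nonzero multiple of `z β` plus monomials of degree `β`, each of which has a
factor of smaller height whose degree is again outside the closed set of tangent roots. -/
lemma coord_mem {J : Ideal (ZDelta b)} (hJ : J.IsHopfIdeal k)
    (hJ' : ∀ (δ : ZDelta b →ₗ[k] k) (f : ZDelta b), f ∈ J → δ f ≠ 0 →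
      ∃ ν, ∃ f' ∈ J, f' ∈ gradedPart b ν ∧ δ f' ≠ 0)
    {β : PosRoot b} (hβ : β ∉ tangentRoots J) : z β ∈ J := by
  classical
  induction hn : (ht b β.deg).toNat using Nat.strong_induction_on generalizing β with
  | _ n ih =>
  subst hn
  simp only [tangentRoots, Set.mem_ofPred_eq, not_forall] at hβ
  obtain ⟨f, hf, hδ⟩ := hβ
  obtain ⟨ν, f, hf, hfν, hδ⟩ := hJ' _ f hf hδ
  obtain rfl : ν = β.deg := by
    by_contra h
    exact hδ (tangent_eq_zero_of_mem_gradedPart _ (rootVec_mem β) h hfν)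
  have hβ : β ∉ tangentRoots J := fun h => hδ (h f hf)
  obtain ⟨P, rfl⟩ := hz.exists_aeval_eq f
  have hP := hz.isWeightedHomogeneous hfν
  have key (d : PosRoot b →₀ ℕ) (hd : d ∈ P.support) (hdβ : d ≠ Finsupp.single β 1) :
      ∃ i, i ≠ β ∧ z i ∈ J ∧ ∃ f' : ZDelta b,
        MvPolynomial.aeval z (MvPolynomial.monomial d (P.coeff d)) = z i * f' := by
    have hw := hP (MvPolynomial.mem_support_iff.1 hd)
    obtain ⟨i, hi, hiB⟩ := (closedBySums_tangentRoots hJ).exists_notMem_of_weight_eq hβ id hw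
    obtain ⟨e, rfl⟩ : ∃ e, d = Finsupp.single i 1 + e := by
      refine exists_add_of_le (Finsupp.single_le_iff.2 ?_)
      exact Nat.one_le_iff_ne_zero.2 (Finsupp.mem_support_iff.1 hi)
    have hw' : i.deg + Finsupp.weight PosRoot.deg e = β.deg := by
      rw [← hw, map_add, Finsupp.weight_single, one_smul]
    have he : e ≠ 0 := by
      rintro rfl
      rw [map_zero, add_zero] at hw'
      exact hdβ (by rw [deg_injective hw', add_zero])
    have hlt : ht b i.deg < ht b β.deg := by
      rw [← hw', map_add]
      exact lt_add_of_pos_right _ (ht_weight_pos he)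
    refine ⟨i, ?_, ih _ ?_ hiB rfl, MvPolynomial.aeval z
      (MvPolynomial.monomial e (P.coeff (Finsupp.single i 1 + e))), ?_⟩
    · rintro rfl
      exact lt_irrefl _ hlt
    · have := ht_deg_pos i
      omega
    · rw [← MvPolynomial.aeval_X (R := k) z i, ← map_mul, MvPolynomial.X,
        MvPolynomial.monomial_mul, one_mul]
  have hsum : MvPolynomial.aeval z P = ∑ d ∈ P.support,
      MvPolynomial.aeval z (MvPolynomial.monomial d (P.coeff d)) := by
    conv_lhs => rw [P.as_sum, map_sum]
  have hmem : Finsupp.single β 1 ∈ P.support := by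
    by_contra hmem
    refine hδ ?_
    rw [hsum, map_sum]
    refine Finset.sum_eq_zero fun d hd => ?_
    obtain ⟨i, hi, -, f', hf'⟩ := key d hd fun h => hmem (h ▸ hd)
    rw [hf', tangent_mul, hz.apply_one, zero_mul, zero_add, tangent_eq_zero_of_mem_gradedPart _
      (rootVec_mem β) (fun h => hi (deg_injective h)) (hz.mem_gradedPart i), zero_mul]
  rw [← Finset.add_sum_erase _ _ hmem] at hsum
  have hrest : ∑ d ∈ P.support.erase (Finsupp.single β 1),
      MvPolynomial.aeval z (MvPolynomial.monomial d (P.coeff d)) ∈ J := by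
    refine Ideal.sum_mem _ fun d hd => ?_
    obtain ⟨i, -, hi, f', hf'⟩ := key d (Finset.mem_of_mem_erase hd) (Finset.ne_of_mem_erase hd)
    rw [hf']
    exact J.mul_mem_right _ hi
  have h1 : P.coeff (Finsupp.single β 1) • z β ∈ J := by
    have h2 := J.sub_mem hf hrest
    rwa [hsum, add_sub_cancel_right, ← mul_one (P.coeff _), ← smul_eq_mul,
      ← MvPolynomial.smul_monomial, map_smul, ← MvPolynomial.X, MvPolynomial.aeval_X] at h2
  have h2 : _ • (_ • z β) ∈ J := Submodule.smul_of_tower_mem J (P.coeff (Finsupp.single β 1))⁻¹ h1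
  rwa [smul_smul, inv_mul_cancel₀ (MvPolynomial.mem_support_iff.1 hmem), one_smul] at h2

lemma tangent_rootIdeal {B : Set (PosRoot b)} {γ : PosRoot b} (hγ : γ ∈ B) {f : ZDelta b}
    (hf : f ∈ rootIdeal z B) : tangent (rootVec γ) (rootVec_mem_nPlus γ) f = 0 := by
  induction hf using Submodule.span_induction with
  | zero => exact map_zero _
  | add x y _ _ hx hy => rw [map_add, hx, hy, add_zero]
  | smul a x hx h =>
    have hx1 : x 1 = 0 := hz.mem_rootIdeal_iff.1 hx 1 fun β _ => hz.apply_one β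
    rw [smul_eq_mul, tangent_mul, h, hx1, mul_zero, mul_zero, add_zero]
  | mem x hx =>
    obtain ⟨β, hβ, rfl⟩ := hx
    refine tangent_eq_zero_of_mem_gradedPart _ (rootVec_mem γ) (fun h => hβ ?_) (hz.mem_gradedPart β)
    rwa [deg_injective h]

/-- Modulo `I(B)`, a regular function is a polynomial in the coordinates from `B`. -/
lemma exists_sub_mem_rootIdeal (B : Set (PosRoot b)) (f : ZDelta b) :
    ∃ P : MvPolynomial B k, f - MvPolynomial.aeval (fun β : B => z β) P ∈ rootIdeal z B := by
  classical
  obtain ⟨Q, rfl⟩ := hz.exists_aeval_eq f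
  refine ⟨MvPolynomial.aeval (fun β => if h : β ∈ B then MvPolynomial.X ⟨β, h⟩ else 0) Q,
    hz.mem_rootIdeal_iff.2 fun u hu => ?_⟩
  rw [sub_eq_add_neg, ← neg_one_smul k, add_apply, smul_apply]
  have h : ((MvPolynomial.aeval fun β : B => z β u : MvPolynomial B k →ₐ[k] k).comp
      (MvPolynomial.aeval (fun β => if h : β ∈ B then (MvPolynomial.X ⟨β, h⟩ : MvPolynomial B k)
        else 0) : MvPolynomial (PosRoot b) k →ₐ[k] MvPolynomial B k)) =
      (MvPolynomial.aeval fun β => z β u) := by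
    refine MvPolynomial.algHom_ext fun β => ?_
    rw [AlgHom.comp_apply, MvPolynomial.aeval_X, MvPolynomial.aeval_X]
    split_ifs with hβ
    · rw [MvPolynomial.aeval_X]
    · rw [map_zero, hu β hβ]
  have h1 := AlgHom.congr_fun h Q
  rw [AlgHom.comp_apply] at h1
  rw [aeval_apply, aeval_apply]
  rw [neg_one_mul, ← sub_eq_add_neg]
  exact sub_eq_zero.2 h1.symm

/-- The coordinates from `B` are algebraically independent modulo `I(B)`. -/
lemma eq_zero_of_aeval_mem_rootIdeal {B : Set (PosRoot b)} {P : MvPolynomial B k}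
    (hP : MvPolynomial.aeval (fun β : B => z β) P ∈ rootIdeal z B) : P = 0 := by
  classical
  refine MvPolynomial.funext fun c => ?_
  obtain ⟨u, hu⟩ := hz.exists_point fun β => if h : β ∈ B then c ⟨β, h⟩ else 0
  have h := hz.mem_rootIdeal_iff.1 hP u fun β hβ => by rw [hu, dif_neg hβ]
  rw [aeval_apply] at h
  rw [map_zero, ← h]
  congr 2
  ext β
  rw [hu, dif_pos β.2]

/-- If all the invariant derivatives along the roots of `B` of a function lie in `I(B)`, then the
function is constant modulo `I(B)`. The matrix of the derivations on the coordinates is triangular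
for the height, with nonzero constants on the diagonal, so that a variable of largest height would
give a nonzero derivative. -/
lemma exists_sub_algebraMap_mem {B : Set (PosRoot b)} (hB : ClosedBySums B) {f : ZDelta b}
    (hf : ∀ γ ∈ B, invDeriv (rootVec γ) (rootVec_mem_nPlus γ) f ∈ rootIdeal z B) :
    ∃ a : k, f - algebraMap k _ a ∈ rootIdeal z B := by
  classical
  have := Fintype.ofFinite B
  obtain ⟨P, hP⟩ := hz.exists_sub_mem_rootIdeal B f
  have hD (γ : B) : ∑ β : B, MvPolynomial.aeval (fun β : B => z β) (MvPolynomial.pderiv β P) *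
      invDeriv (rootVec γ.1) (rootVec_mem_nPlus γ.1) (z β) ∈ rootIdeal z B := by
    rw [← invDeriv_aeval]
    have h1 := invDeriv_mem (hz.isHopfIdeal_rootIdeal hB) (rootVec_mem_nPlus γ.1)
      (fun f hf => hz.tangent_rootIdeal γ.2 hf) hP
    rw [map_sub] at h1
    simpa using (rootIdeal z B).sub_mem (hf γ γ.2) h1
  have hpd : ∀ γ : B, MvPolynomial.pderiv γ P = 0 := by
    by_contra! hcon
    obtain ⟨γ, hγ, hmax⟩ := Finset.exists_max_image
      (Finset.univ.filter fun γ : B => MvPolynomial.pderiv γ P ≠ 0) (fun γ => ht b γ.1.deg)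
      (by obtain ⟨γ, hγ⟩ := hcon; exact ⟨γ, by simpa using hγ⟩)
    rw [Finset.mem_filter] at hγ
    refine hγ.2 (hz.eq_zero_of_aeval_mem_rootIdeal ?_)
    have hdeg (β : B) := invDeriv_mem_gradedPart (rootVec_mem_nPlus γ.1) (rootVec_mem γ.1)
      (hz.mem_gradedPart β.1)
    have h1 := hD γ
    rw [Finset.sum_eq_single γ (fun β _ hβ => ?_) (by simp)] at h1
    · have h2 := (hz.eq_algebraMap_of_ht_nonpos (by simp) (hdeg γ)).1
      rw [invDeriv_apply_one] at h2
      rw [h2, mul_comm, ← Algebra.smul_def] at h1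
      have h3 := hz.tangent_coord_ne_zero (rootVec_mem_nPlus γ.1) (rootVec_mem γ.1)
        (rootVec_ne_zero γ.1)
      have h4 := Submodule.smul_of_tower_mem (rootIdeal z B)
        (tangent (rootVec γ.1) (rootVec_mem_nPlus γ.1) (z γ.1))⁻¹ h1
      rwa [smul_smul, inv_mul_cancel₀ h3, one_smul] at h4
    · by_cases h0 : MvPolynomial.pderiv β P = 0
      · rw [h0, map_zero, zero_mul]
      · have hle := hmax β (by simpa using h0)
        rw [(hz.eq_algebraMap_of_ht_nonpos (by rw [map_sub]; linarith) (hdeg β)).2, mul_zero]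
        intro h
        exact hβ (Subtype.ext (deg_injective (sub_eq_zero.1 h)))
  have hC : P = MvPolynomial.C (P.coeff 0) := by
    ext d
    rw [MvPolynomial.coeff_C]
    split_ifs with h
    · rw [h]
    · obtain ⟨i, hi⟩ := Finsupp.support_nonempty_iff.2 (Ne.symm h)
      obtain ⟨e, rfl⟩ : ∃ e, d = e + Finsupp.single i 1 := by
        obtain ⟨e, he⟩ := exists_add_of_le (Finsupp.single_le_iff.2
          (Nat.one_le_iff_ne_zero.2 (Finsupp.mem_support_iff.1 hi)))
        exact ⟨e, by rw [he, add_comm]⟩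
      have h1 := MvPolynomial.coeff_pderiv (i := i) P e
      rw [hpd, MvPolynomial.coeff_zero, eq_comm] at h1
      exact (mul_eq_zero.1 h1).resolve_right (Nat.cast_add_one_ne_zero _)
  refine ⟨P.coeff 0, ?_⟩
  rwa [hC, MvPolynomial.aeval_C] at hP

/-- A Hopf ideal spanned by homogeneous elements is `I(B)` for its set `B` of tangent roots. -/
lemma mem_rootIdeal_of_mem {J : Ideal (ZDelta b)} (hJ : J.IsHopfIdeal k) {ν : RootLattice H}
    {f : ZDelta b} (hf : f ∈ J) (hfν : f ∈ gradedPart b ν) :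
    f ∈ rootIdeal z (tangentRoots J) := by
  induction hn : (ht b ν + 1).toNat using Nat.strong_induction_on generalizing ν f with
  | _ n ih =>
  subst hn
  by_cases hν : ht b ν < 0
  · rw [(hz.eq_algebraMap_of_ht_nonpos hν.le hfν).2 (by rintro rfl; simp at hν)]
    exact zero_mem _
  obtain ⟨a, ha⟩ := hz.exists_sub_algebraMap_mem (closedBySums_tangentRoots hJ) (f := f)
    fun γ hγ => by
      refine ih _ ?_ (invDeriv_mem hJ _ hγ hf)
        (invDeriv_mem_gradedPart _ (rootVec_mem γ) hfν) rfl
      rw [map_sub]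
      have := ht_deg_pos γ
      omega
  have hf1 : f 1 = 0 := hJ.counit_eq_zero hf
  have h1 := hz.mem_rootIdeal_iff.1 ha 1 fun β _ => hz.apply_one β
  rw [Algebra.algebraMap_eq_smul_one, sub_eq_add_neg, ← neg_smul, add_apply, smul_apply, hf1,
    one_apply, mul_one, zero_add, neg_eq_zero] at h1
  rwa [h1, map_zero, sub_zero] at ha

open Classical in
theorem rootIdeal_tangentRoots {J : Ideal (ZDelta b)} (hJ : J.IsHopfIdeal k)
    (hJ' : J.IsHomogeneous (gradedPart b)) : rootIdeal z (tangentRoots J) = J := by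
  refine le_antisymm (Ideal.span_le.2 ?_) fun f hf => ?_
  · rintro _ ⟨β, hβ, rfl⟩
    exact hz.coord_mem hJ (fun δ f => exists_mem_gradedPart_of_ne_zero hJ' δ) hβ
  · rw [← DirectSum.sum_support_decompose (gradedPart b) f]
    exact Ideal.sum_mem _ fun ν _ => hz.mem_rootIdeal_of_mem hJ (hJ' ν hf) (SetLike.coe_mem _)

/-- The correspondence between closed sets of positive roots and graded Hopf ideals. -/
noncomputable def closedSubsetOrderIso : ClosedSubset b ≃o (GradedHopfIdeal b)ᵒᵈ :=
  RelIso.ofSurjective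
    (OrderEmbedding.ofMapLEIff
      (fun B => OrderDual.toDual ⟨rootIdeal z B.1, hz.isHopfIdeal_rootIdeal B.2,
        hz.isHomogeneous_rootIdeal B.1⟩)
      fun _ _ => hz.rootIdeal_le_iff)
    fun J => ⟨⟨tangentRoots (OrderDual.ofDual J).1, closedBySums_tangentRoots J.2.1⟩,
      Subtype.ext (hz.rootIdeal_tangentRoots J.2.1 J.2.2)⟩

end IsRootCoordinates

end HopfIdeals

end UnipotentCoord

theorem theorem3 {k g : Type*} [Field k] [IsAlgClosed k] [CharZero k] [LieRing g]
    [LieAlgebra k g] [FiniteDimensional k g] [LieAlgebra.IsSemisimple k g]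
    (H : LieSubalgebra k g) [H.IsCartanSubalgebra]
    (b : (LieAlgebra.IsKilling.rootSystem H).Base) :
    (∃ z : UnipotentCoord.PosRoot b → UnipotentCoord.ZDelta b,
      UnipotentCoord.IsRootCoordinates b z) ∧
    ∀ z : UnipotentCoord.PosRoot b → UnipotentCoord.ZDelta b,
      UnipotentCoord.IsRootCoordinates b z →
      ∃ e : UnipotentCoord.ClosedSubset b ≃o (UnipotentCoord.GradedHopfIdeal b)ᵒᵈ,
        ∀ B : UnipotentCoord.ClosedSubset b,
          (OrderDual.ofDual (e B)).1 = UnipotentCoord.rootIdeal z B.1 :=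
  ⟨UnipotentCoord.exists_isRootCoordinates b, fun _ hz => ⟨hz.closedSubsetOrderIso, fun _ => rfl⟩⟩
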